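/- Let $\kappa\in\mathbb R$. For $\kappa>0$ the perimeter bound below is $2\pi/\sqrt\kappa$; for $\kappa\le 0$ there is no bound. For points $p,x,y$ of a metric space with $p\ne x$, $p\neq y$ and $|px|+|py|+|xy|$ less than the perimeter bound, let $\tilde\angle^\kappa(p;x,y)$ be the angle at $\tilde p$ of a triangle $\tilde p\tilde x\tilde y$ with the same side lengths in the model plane of constant curvature $\kappa$; otherwise the model angle is undefined. A complete metric space with intrinsic metric (the distance of any two points is the infimum of the lengths of curves joining them) is called an Alexandrov space with curvature $\ge\kappa$ if $$\tilde\angle^\kappa(p;x,y)+\tilde\angle^\kappa(p;y,z)+\tilde\angle^\kappa(p;z,x)\le 2\pi$$ for all points $p,x,y,z$ for which the three model angles are defined. Let $\mathcal X$ be a complete space with intrinsic metric. (a) Let $\kappa>0$. If every quadruple $p,x^1,x^2,x^3\in\mathcal X$ satisfies $$\Bigl(\sum_{i=1}^3\cos(\sqrt\kappa\,|px^i|)\Bigr)^2\le\sum_{i,j=1}^3\cos(\sqrt\kappa\,|x^ix^j|),$$ then $\mathcal X$ is an Alexandrov space with curvature $\ge\kappa$. If $\operatorname{diam}\mathcal X\le\pi/\sqrt\kappa$,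 then the converse holds too, so that $\mathcal X$ is an Alexandrov space with curvature $\ge\kappa$ if and only if every quadruple satisfies this inequality. In particular, for $\kappa=1$ and $\operatorname{diam}\mathcal X\le\pi$ the characterizing inequality is $\bigl(\sum_i\cos|px^i|\bigr)^2\le\sum_{i,j}\cos|x^ix^j|$. (b) $\mathcal X$ is an Alexandrov space with curvature $\ge 0$ if and only if every quadruple $p,x,y,z\in\mathcal X$ satisfies $$|px|^2+|py|^2+|pz|^2\ge\tfrac13\bigl(|xy|^2+|yz|^2+|zx|^2\bigr).$$ (c) Let $\kappa<0$. Then $\mathcal X$ is an Alexandrov space with curvature $\ge\kappa$ if and only if every quadruple $p,x^1,x^2,x^3\in\mathcal X$ satisfies $$\Bigl(\sum_{i=1}^3\cosh(\sqrt{-\kappa}\,|px^i|)\Bigr)^2\ge\sum_{i,j=1}^3\cosh(\sqrt{-\kappa}\,|x^ix^j|).$$ In particular, for $\kappa=-1$ the inequality is $\bigl(\sum_i\cosh|px^i|\bigr)^2\ge\sum_{i,j}\cosh|x^ix^j|$. -/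

import Mathlib

namespace AlexandrovCBB

/-- The metric of `X` is intrinsic: the distance between any two points is the infimum of the
lengths of the continuous paths joining them (in particular any two points are joined by a
rectifiable path). -/
def IsIntrinsic (X : Type*) [MetricSpace X] : Prop :=
  ∀ x y : X, edist x y = ⨅ γ : Path x y, eVariationOn (γ : unitInterval → X) Set.univ

/-- The angle between the sides of lengths `a` and `b`, opposite to the side of length `c`, of a
triangle with side lengths `a`, `b`, `c` in the model plane of constant curvature `κ`
(spherical, Euclidean and hyperbolic law of cosines). -/
noncomputable def modelAngle (κ a b c : ℝ) : ℝ :=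
  if 0 < κ then
    Real.arccos ((Real.cos (√κ * c) - Real.cos (√κ * a) * Real.cos (√κ * b)) /
      (Real.sin (√κ * a) * Real.sin (√κ * b)))
  else if κ < 0 then
    Real.arccos ((Real.cosh (√(-κ) * a) * Real.cosh (√(-κ) * b) - Real.cosh (√(-κ) * c)) /
      (Real.sinh (√(-κ) * a) * Real.sinh (√(-κ) * b)))
  else
    Real.arccos ((a ^ 2 + b ^ 2 - c ^ 2) / (2 * a * b))

/-- The model angle at `p` of the triple `p, x, y` is defined: `p` differs from `x` and `y` and,
if `κ > 0`, the perimeter of the triple is less than `2π / √κ`. -/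
def AngleDefined {X : Type*} [MetricSpace X] (κ : ℝ) (p x y : X) : Prop :=
  p ≠ x ∧ p ≠ y ∧ (0 < κ → dist p x + dist p y + dist x y < 2 * Real.pi / √κ)

/-- The model angle at `p` of the triple `p, x, y`. -/
noncomputable def angleAt {X : Type*} [MetricSpace X] (κ : ℝ) (p x y : X) : ℝ :=
  modelAngle κ (dist p x) (dist p y) (dist x y)

/-- Alexandrov spaces with curvature `≥ κ`: complete spaces with intrinsic metric in which, for
every quadruple `p, x, y, z`, the three model angles at `p` sum up to at most `2π`, whenever all
three are defined. -/
structure IsAlexandrovSpace (κ : ℝ) (X : Type*) [MetricSpace X] : Prop where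
  complete : CompleteSpace X
  intrinsic : IsIntrinsic X
  comparison : ∀ p x y z : X,
    AngleDefined κ p x y → AngleDefined κ p y z → AngleDefined κ p z x →
      angleAt κ p x y + angleAt κ p y z + angleAt κ p z x ≤ 2 * Real.pi

/-- The quadruple inequality for curvature `κ > 0`. -/
def SphericalInequality (κ : ℝ) (X : Type*) [MetricSpace X] : Prop :=
  ∀ (p : X) (x : Fin 3 → X),
    (∑ i, Real.cos (√κ * dist p (x i))) ^ 2 ≤ ∑ i, ∑ j, Real.cos (√κ * dist (x i) (x j))

/-- The quadruple inequality for curvature `κ < 0`. -/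
def HyperbolicInequality (κ : ℝ) (X : Type*) [MetricSpace X] : Prop :=
  ∀ (p : X) (x : Fin 3 → X),
    ∑ i, ∑ j, Real.cosh (√(-κ) * dist (x i) (x j)) ≤ (∑ i, Real.cosh (√(-κ) * dist p (x i))) ^ 2

/-- The quadruple inequality for curvature `0`. -/
def EuclideanInequality (X : Type*) [MetricSpace X] : Prop :=
  ∀ p x y z : X,
    (1 / 3 : ℝ) * (dist x y ^ 2 + dist y z ^ 2 + dist z x ^ 2) ≤
      dist p x ^ 2 + dist p y ^ 2 + dist p z ^ 2

end AlexandrovCBB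

/-!
For fixed `p`, let `g x y` be the product of the (generalized) sines of `|px|`, `|py|` and the
cosine of the model angle at `p`; it extends continuously through the law of cosines. The angle
condition at `p` says that the 3 × 3 matrix `g (x i) (x j)` is copositive, whereas the quadruple
inequality only says that the sum of its entries is nonnegative.

So the quadruple inequality follows from the angle condition by taking all weights equal to `1`.
For `κ > 0` this needs all perimeters to be at most `2π / √κ`; after passing to an ultralimit,
where geodesics exist, this is a consequence of the diameter bound, and perimeters equal to
`2π / √κ` are reached by moving the points slightly towards `p`.

In the other direction, the quadruple inequality in the ultralimit, applied repeatedly at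
centroids, yields the median inequality of the model plane. Hence moving a point along a geodesic
towards `p` multiplies its row of `g` by at most the ratio of the sines, so any weights can be
realized by moving the points, and the sum of entries being nonnegative becomes copositivity.
-/

namespace AlexandrovCBB

open Filter Topology Set

open scoped NNReal

section Copositive

/-- A kernel is copositive if its quadratic form is nonnegative on the nonnegative orthant. -/
def Copositive {ι : Type*} [Fintype ι] (g : ι → ι → ℝ) : Prop :=
  ∀ a : ι → ℝ, 0 ≤ a → 0 ≤ ∑ i, ∑ j, a i * a j * g i j

lemma Copositive.sum_nonneg {ι : Type*} [Fintype ι] {g : ι → ι → ℝ} (hg : Copositive g) :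
    0 ≤ ∑ i, ∑ j, g i j := by
  simpa using hg 1 zero_le_one

lemma copositive_fin_three_iff {g : Fin 3 → Fin 3 → ℝ} {s : Fin 3 → ℝ}
    (hsymm : ∀ i j, g i j = g j i) (hdiag : ∀ i, g i i = s i ^ 2) :
    Copositive g ↔ ∀ a b c : ℝ, 0 ≤ a → 0 ≤ b → 0 ≤ c →
      0 ≤ (a * s 0) ^ 2 + (b * s 1) ^ 2 + (c * s 2) ^ 2 +
        2 * (a * b * g 0 1 + b * c * g 1 2 + c * a * g 2 0) := by
  have expand (a : Fin 3 → ℝ) : ∑ i, ∑ j, a i * a j * g i j =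
      (a 0 * s 0) ^ 2 + (a 1 * s 1) ^ 2 + (a 2 * s 2) ^ 2 +
        2 * (a 0 * a 1 * g 0 1 + a 1 * a 2 * g 1 2 + a 2 * a 0 * g 2 0) := by
    simp only [Fin.sum_univ_three, hdiag, hsymm 1 0, hsymm 2 1, hsymm 0 2]
    ring
  refine ⟨fun h a b c ha hb hc => ?_, fun h a ha => ?_⟩
  · have h0 : 0 ≤ ![a, b, c] := by
      intro i
      fin_cases i <;> assumption
    simpa [expand] using h ![a, b, c] h0
  · rw [expand]
    exact h _ _ _ (ha 0) (ha 1) (ha 2)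

-- The squared norm of `a u + b v + c w`, where the unit vectors `u`, `v`, `w` of the plane make
-- the angles `α`, `β`, `γ` with each other.
lemma cos_form_eq_sq_add_sq {α β γ : ℝ} (h : α + β + γ = 2 * Real.pi) (a b c : ℝ) :
    a ^ 2 + b ^ 2 + c ^ 2 + 2 * (a * b * Real.cos α + b * c * Real.cos β + c * a * Real.cos γ) =
      (b + a * Real.cos α + c * Real.cos β) ^ 2 + (a * Real.sin α - c * Real.sin β) ^ 2 := by
  have hγ : Real.cos γ = Real.cos α * Real.cos β - Real.sin α * Real.sin β := by
    rw [show γ = 2 * Real.pi - (α + β) by linarith, Real.cos_two_pi_sub, Real.cos_add]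
  rw [hγ]
  linear_combination -a ^ 2 * Real.sin_sq_add_cos_sq α - c ^ 2 * Real.sin_sq_add_cos_sq β

lemma cos_form_sin_eq_zero {α β γ : ℝ} (h : α + β + γ = 2 * Real.pi) :
    Real.sin β ^ 2 + Real.sin γ ^ 2 + Real.sin α ^ 2 +
      2 * (Real.sin β * Real.sin γ * Real.cos α + Real.sin γ * Real.sin α * Real.cos β +
        Real.sin α * Real.sin β * Real.cos γ) = 0 := by
  have hγ : Real.sin γ = -(Real.sin α * Real.cos β + Real.cos α * Real.sin β) := by
    rw [show γ = 2 * Real.pi - (α + β) by linarith, Real.sin_two_pi_sub, Real.sin_add]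
  rw [cos_form_eq_sq_add_sq h, hγ]
  ring

lemma add_add_le_two_pi_of_cos_form_nonneg {α β γ : ℝ} (hα : α ∈ Icc 0 Real.pi)
    (hβ : β ∈ Icc 0 Real.pi) (hγ : γ ∈ Icc 0 Real.pi)
    (h : ∀ a b c : ℝ, 0 ≤ a → 0 ≤ b → 0 ≤ c → 0 ≤ a ^ 2 + b ^ 2 + c ^ 2 +
      2 * (a * b * Real.cos α + b * c * Real.cos β + c * a * Real.cos γ)) :
    α + β + γ ≤ 2 * Real.pi := by
  by_contra! hlt
  have hπ := Real.pi_pos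
  -- Shrink the angles proportionally until they sum up to `2π`.
  set r := 2 * Real.pi / (α + β + γ) with hr
  have hr0 : 0 < r := div_pos (by linarith) (by linarith)
  have hr1 : r < 1 := (div_lt_one (by linarith)).2 hlt
  have hsum : r * α + r * β + r * γ = 2 * Real.pi := by
    rw [← mul_add, ← mul_add, hr, div_mul_cancel₀ _ (by linarith)]
  have shrink {θ : ℝ} (h0 : 0 < θ) (h1 : θ ≤ Real.pi) :
      0 < Real.sin (r * θ) ∧ Real.cos θ < Real.cos (r * θ) := by
    have hlt : r * θ < θ := mul_lt_of_lt_one_left h0 hr1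
    exact ⟨Real.sin_pos_of_pos_of_lt_pi (by positivity) (hlt.trans_le h1),
      Real.cos_lt_cos_of_nonneg_of_le_pi (by positivity) h1 hlt⟩
  obtain ⟨sα, cα⟩ := shrink (by linarith [hβ.2, hγ.2] : 0 < α) hα.2
  obtain ⟨sβ, cβ⟩ := shrink (by linarith [hα.2, hγ.2] : 0 < β) hβ.2
  obtain ⟨sγ, cγ⟩ := shrink (by linarith [hα.2, hβ.2] : 0 < γ) hγ.2
  refine (h _ _ _ sβ.le sγ.le sα.le).not_gt ?_
  calc _ < _ := by gcongr
    _ = 0 := cos_form_sin_eq_zero hsum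

lemma exists_ge_add_add_eq_two_pi {α β γ : ℝ} (hα : α ∈ Icc 0 Real.pi) (hβ : β ∈ Icc 0 Real.pi)
    (hγ : γ ∈ Icc 0 Real.pi) (h : α + β + γ ≤ 2 * Real.pi) :
    ∃ β' ∈ Icc β Real.pi, ∃ γ' ∈ Icc γ Real.pi, α + β' + γ' = 2 * Real.pi := by
  rcases le_total Real.pi (α + β) with hαβ | hαβ
  · exact ⟨β, ⟨le_rfl, hβ.2⟩, 2 * Real.pi - α - β, ⟨by linarith, by linarith⟩, by ring⟩
  · exact ⟨Real.pi - α, ⟨by linarith, by linarith [hα.1]⟩, Real.pi, ⟨hγ.2, le_rfl⟩, by ring⟩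

lemma cos_form_nonneg_of_add_add_le_two_pi {α β γ : ℝ} (hα : α ∈ Icc 0 Real.pi)
    (hβ : β ∈ Icc 0 Real.pi) (hγ : γ ∈ Icc 0 Real.pi) (h : α + β + γ ≤ 2 * Real.pi)
    {a b c : ℝ} (ha : 0 ≤ a) (hb : 0 ≤ b) (hc : 0 ≤ c) :
    0 ≤ a ^ 2 + b ^ 2 + c ^ 2 +
      2 * (a * b * Real.cos α + b * c * Real.cos β + c * a * Real.cos γ) := by
  obtain ⟨β', hβ', γ', hγ', hsum⟩ := exists_ge_add_add_eq_two_pi hα hβ hγ h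
  calc 0 ≤ a ^ 2 + b ^ 2 + c ^ 2 +
        2 * (a * b * Real.cos α + b * c * Real.cos β' + c * a * Real.cos γ') := by
        rw [cos_form_eq_sq_add_sq hsum]
        positivity
    _ ≤ _ := by
        gcongr
        · exact Real.cos_le_cos_of_nonneg_of_le_pi hβ.1 hβ'.2 hβ'.1
        · exact Real.cos_le_cos_of_nonneg_of_le_pi hγ.1 hγ'.2 hγ'.1

lemma mul_mul_cos_arccos_div {u s t : ℝ} (hs : 0 < s) (ht : 0 < t) (hu : |u| ≤ s * t) :
    s * t * Real.cos (Real.arccos (u / (s * t))) = u := by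
  have hst := mul_pos hs ht
  have hle : |u / (s * t)| ≤ 1 := by rwa [abs_div, abs_of_pos hst, div_le_one hst]
  rw [Real.cos_arccos (abs_le.1 hle).1 (abs_le.1 hle).2]
  field_simp

variable {g : Fin 3 → Fin 3 → ℝ} {s : Fin 3 → ℝ}

lemma arccos_mem_Icc (u : ℝ) : Real.arccos u ∈ Icc 0 Real.pi :=
  ⟨Real.arccos_nonneg u, Real.arccos_le_pi u⟩

lemma copositive_iff_arccos_add_le (hsymm : ∀ i j, g i j = g j i) (hdiag : ∀ i, g i i = s i ^ 2)
    (hbound : ∀ i j, |g i j| ≤ s i * s j) (hs : ∀ i, 0 < s i) :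
    Copositive g ↔ Real.arccos (g 0 1 / (s 0 * s 1)) + Real.arccos (g 1 2 / (s 1 * s 2)) +
      Real.arccos (g 2 0 / (s 2 * s 0)) ≤ 2 * Real.pi := by
  have hcos (i j) := mul_mul_cos_arccos_div (hs i) (hs j) (hbound i j)
  have form_eq (a b c : ℝ) : (a * s 0) ^ 2 + (b * s 1) ^ 2 + (c * s 2) ^ 2 +
      2 * (a * b * g 0 1 + b * c * g 1 2 + c * a * g 2 0) =
      (a * s 0) ^ 2 + (b * s 1) ^ 2 + (c * s 2) ^ 2 +
      2 * (a * s 0 * (b * s 1) * Real.cos (Real.arccos (g 0 1 / (s 0 * s 1))) +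
        b * s 1 * (c * s 2) * Real.cos (Real.arccos (g 1 2 / (s 1 * s 2))) +
        c * s 2 * (a * s 0) * Real.cos (Real.arccos (g 2 0 / (s 2 * s 0)))) := by
    linear_combination -2 * (a * b * hcos 0 1 + b * c * hcos 1 2 + c * a * hcos 2 0)
  rw [copositive_fin_three_iff hsymm hdiag]
  constructor
  · intro h
    refine add_add_le_two_pi_of_cos_form_nonneg (arccos_mem_Icc _) (arccos_mem_Icc _)
      (arccos_mem_Icc _) fun a b c ha hb hc => ?_
    have := h (a / s 0) (b / s 1) (c / s 2) (div_nonneg ha (hs 0).le) (div_nonneg hb (hs 1).le)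
      (div_nonneg hc (hs 2).le)
    rw [form_eq] at this
    simpa only [div_mul_cancel₀ _ (hs _).ne'] using this
  · intro h a b c ha hb hc
    rw [form_eq]
    exact cos_form_nonneg_of_add_add_le_two_pi (arccos_mem_Icc _) (arccos_mem_Icc _)
      (arccos_mem_Icc _) h (mul_nonneg ha (hs 0).le) (mul_nonneg hb (hs 1).le)
      (mul_nonneg hc (hs 2).le)

lemma binary_form_nonneg {x y z p q : ℝ} (hx : |x| ≤ y * z) (hp : 0 ≤ p) (hq : 0 ≤ q) :
    0 ≤ (p * y) ^ 2 + (q * z) ^ 2 + 2 * (p * q * x) := by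
  have := mul_le_mul_of_nonneg_left (abs_le.1 hx).1 (mul_nonneg hp hq)
  nlinarith [sq_nonneg (p * y - q * z)]

lemma copositive_of_eq_zero (hsymm : ∀ i j, g i j = g j i) (hdiag : ∀ i, g i i = s i ^ 2)
    (hbound : ∀ i j, |g i j| ≤ s i * s j) {k : Fin 3} (hk : s k = 0) : Copositive g := by
  have hzero (j : Fin 3) : g k j = 0 ∧ g j k = 0 := by
    rw [hsymm j k, and_self, ← abs_nonpos_iff]
    simpa [hk] using hbound k j
  rw [copositive_fin_three_iff hsymm hdiag]
  intro a b c ha hb hc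
  obtain rfl | rfl | rfl : k = 0 ∨ k = 1 ∨ k = 2 := by fin_cases k <;> simp
  · simpa [hk, hzero] using binary_form_nonneg (hbound 1 2) hb hc
  · simpa [hk, hzero, mul_comm a c, hsymm 2 0] using binary_form_nonneg (hbound 0 2) ha hc
  · simpa [hk, hzero] using binary_form_nonneg (hbound 0 1) ha hb

lemma copositive_of_arccos_add_le (hsymm : ∀ i j, g i j = g j i) (hdiag : ∀ i, g i i = s i ^ 2)
    (hbound : ∀ i j, |g i j| ≤ s i * s j) (hs : ∀ i, 0 ≤ s i)
    (h : (∀ i, 0 < s i) → Real.arccos (g 0 1 / (s 0 * s 1)) + Real.arccos (g 1 2 / (s 1 * s 2)) +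
      Real.arccos (g 2 0 / (s 2 * s 0)) ≤ 2 * Real.pi) : Copositive g := by
  by_cases hpos : ∀ i, 0 < s i
  · exact (copositive_iff_arccos_add_le hsymm hdiag hbound hpos).2 (h hpos)
  · push Not at hpos
    obtain ⟨k, hk⟩ := hpos
    exact copositive_of_eq_zero hsymm hdiag hbound (hk.antisymm (hs k))

end Copositive

section Contraction

variable {Y ι : Type*} [Fintype ι] {g : Y → Y → ℝ} {R : Y → Y → Prop}

/-- Replacing `x` by `x'` multiplies the kernel `g` by at most `ρ`, and preserves `R`, against all
points related to `x`. -/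
def Contracts (g : Y → Y → ℝ) (R : Y → Y → Prop) (ρ : ℝ) (x x' : Y) : Prop :=
  ∀ w, R x w → g x' w ≤ ρ * g x w ∧ R x' w

lemma sum_sum_le_of_contracts (hg : ∀ x y, g x y = g y x) (hR : ∀ x y, R x y → R y x)
    {a : ι → ℝ} (ha : 0 ≤ a) {x x' : ι → Y} (hx : ∀ i j, R (x i) (x j))
    (hxx' : ∀ i, Contracts g R (a i) (x i) (x' i)) :
    ∑ i, ∑ j, g (x' i) (x' j) ≤ ∑ i, ∑ j, a i * a j * g (x i) (x j) := by
  gcongr with i _ j _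
  obtain ⟨hi, hRi⟩ := hxx' i (x j) (hx i j)
  calc g (x' i) (x' j) = g (x' j) (x' i) := hg _ _
    _ ≤ a j * g (x j) (x' i) := (hxx' j (x' i) (hR _ _ hRi)).1
    _ ≤ a j * (a i * g (x i) (x j)) := by
        rw [hg (x j)]
        exact mul_le_mul_of_nonneg_left hi (ha j)
    _ = a i * a j * g (x i) (x j) := by ring

lemma copositive_of_forall_le_one {g : ι → ι → ℝ}
    (h : ∀ a : ι → ℝ, 0 ≤ a → a ≤ 1 → 0 ≤ ∑ i, ∑ j, a i * a j * g i j) : Copositive g := by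
  intro a ha
  have hM : 0 < 1 + ∑ i, a i := add_pos_of_pos_of_nonneg one_pos (Finset.sum_nonneg fun i _ => ha i)
  have hle (i : ι) : a i ≤ 1 + ∑ j, a j :=
    (Finset.single_le_sum (fun j _ => ha j) (Finset.mem_univ i)).trans (by simp)
  have hb := h (fun i => a i / (1 + ∑ j, a j)) (fun i => div_nonneg (ha i) hM.le)
    fun i => (div_le_one hM).2 (hle i)
  have scale : ∑ i, ∑ j, a i * a j * g i j = (1 + ∑ i, a i) ^ 2 *
      ∑ i, ∑ j, a i / (1 + ∑ k, a k) * (a j / (1 + ∑ k, a k)) * g i j := by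
    simp only [Finset.mul_sum]
    congr! 2
    field_simp
  rw [scale]
  positivity

lemma copositive_of_exists_contracts (hg : ∀ x y, g x y = g y x) (hR : ∀ x y, R x y → R y x)
    (hnonneg : ∀ x : ι → Y, 0 ≤ ∑ i, ∑ j, g (x i) (x j)) {x : ι → Y}
    (hx : ∀ i j, R (x i) (x j))
    (hcontr : ∀ i, ∀ ρ ∈ Icc (0 : ℝ) 1, ∃ x', Contracts g R ρ (x i) x') :
    Copositive fun i j => g (x i) (x j) := by
  refine copositive_of_forall_le_one fun a ha ha1 => ?_
  choose x' hx' using fun i => hcontr i (a i) ⟨ha i, ha1 i⟩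
  exact (hnonneg x').trans (sum_sum_le_of_contracts hg hR ha hx hx')

end Contraction

section ModelKernels

/-- In the unit sphere, the inner product of the directions at `p` of `x` and `y` times
`sin |px| sin |py|`, as a function of the three distances `a = |px|`, `b = |py|`, `c = |xy|`. -/
noncomputable def sphericalGram (a b c : ℝ) : ℝ :=
  Real.cos c - Real.cos a * Real.cos b

/-- The analogue of `sphericalGram` in the Euclidean plane: the inner product of `x - p` and
`y - p`. -/
noncomputable def euclideanGram (a b c : ℝ) : ℝ :=
  (a ^ 2 + b ^ 2 - c ^ 2) / 2

/-- The analogue of `sphericalGram` in the hyperbolic plane. -/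
noncomputable def hyperbolicGram (a b c : ℝ) : ℝ :=
  Real.cosh a * Real.cosh b - Real.cosh c

/-- The analogue of `sphericalGram` in the model plane of curvature `κ`. -/
noncomputable def modelGram (κ a b c : ℝ) : ℝ :=
  if 0 < κ then sphericalGram (√κ * a) (√κ * b) (√κ * c)
  else if κ < 0 then hyperbolicGram (√(-κ) * a) (√(-κ) * b) (√(-κ) * c)
  else euclideanGram a b c

/-- The sine function of the model plane of curvature `κ`, where a circle of radius `a` has length
`2π * modelSin κ a / √|κ|` (`2π * modelSin 0 a` if `κ = 0`). -/
noncomputable def modelSin (κ a : ℝ) : ℝ :=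
  if 0 < κ then Real.sin (√κ * a) else if κ < 0 then Real.sinh (√(-κ) * a) else a

/-- The kernel `G`, evaluated at the distances between the points `p`, `x`, `y`. -/
def gramAt {Y : Type*} [PseudoMetricSpace Y] (G : ℝ → ℝ → ℝ → ℝ) (p x y : Y) : ℝ :=
  G (dist p x) (dist p y) (dist x y)

lemma sphericalGram_comm (a b c : ℝ) : sphericalGram a b c = sphericalGram b a c := by
  simp only [sphericalGram, mul_comm]

lemma euclideanGram_comm (a b c : ℝ) : euclideanGram a b c = euclideanGram b a c := by
  simp only [euclideanGram, add_comm]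

lemma hyperbolicGram_comm (a b c : ℝ) : hyperbolicGram a b c = hyperbolicGram b a c := by
  simp only [hyperbolicGram, mul_comm]

lemma modelGram_comm (κ a b c : ℝ) : modelGram κ a b c = modelGram κ b a c := by
  simp only [modelGram, sphericalGram_comm (_ * a), hyperbolicGram_comm (_ * a),
    euclideanGram_comm a]

lemma gramAt_comm {Y : Type*} [PseudoMetricSpace Y] {G : ℝ → ℝ → ℝ → ℝ}
    (hG : ∀ a b c, G a b c = G b a c) (p x y : Y) : gramAt G p x y = gramAt G p y x := by
  simp only [gramAt, hG (dist p x), dist_comm x y]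

lemma modelGram_of_pos {κ : ℝ} (hκ : 0 < κ) :
    modelGram κ = fun a b c => sphericalGram (√κ * a) (√κ * b) (√κ * c) := by
  ext
  simp only [modelGram, if_pos hκ]

lemma modelGram_of_neg {κ : ℝ} (hκ : κ < 0) :
    modelGram κ = fun a b c => hyperbolicGram (√(-κ) * a) (√(-κ) * b) (√(-κ) * c) := by
  ext
  simp only [modelGram, if_neg hκ.not_gt, if_pos hκ]

lemma modelGram_zero : modelGram 0 = euclideanGram := by
  ext
  simp only [modelGram, lt_irrefl, if_false]

lemma modelAngle_eq_arccos (κ a b c : ℝ) :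
    modelAngle κ a b c = Real.arccos (modelGram κ a b c / (modelSin κ a * modelSin κ b)) := by
  unfold modelAngle modelGram modelSin
  split_ifs
  · rfl
  · rfl
  · rw [euclideanGram, div_div, mul_assoc]

lemma modelGram_self (κ a : ℝ) : modelGram κ a a 0 = modelSin κ a ^ 2 := by
  unfold modelGram modelSin
  split_ifs
  · rw [sphericalGram, mul_zero, Real.cos_zero, Real.sin_sq]
    ring
  · rw [hyperbolicGram, mul_zero, Real.cosh_zero, Real.sinh_sq]
    ring
  · rw [euclideanGram]
    ring

lemma abs_sphericalGram_le {a b c : ℝ} (hc : |a - b| ≤ c) (hc' : c ≤ a + b)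
    (hper : a + b + c ≤ 2 * Real.pi) : |sphericalGram a b c| ≤ Real.sin a * Real.sin b := by
  have upper : Real.cos c ≤ Real.cos (a - b) := by
    rw [← Real.cos_abs (a - b)]
    exact Real.cos_le_cos_of_nonneg_of_le_pi (abs_nonneg _) (by linarith) hc
  have lower : Real.cos (a + b) ≤ Real.cos c := by
    have hc0 := (abs_nonneg _).trans hc
    rcases le_total (a + b) Real.pi with h | h
    · exact Real.cos_le_cos_of_nonneg_of_le_pi hc0 h hc'
    · rw [← Real.cos_two_pi_sub]
      exact Real.cos_le_cos_of_nonneg_of_le_pi hc0 (by linarith) (by linarith)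
  rw [Real.cos_sub] at upper
  rw [Real.cos_add] at lower
  rw [sphericalGram, abs_le]
  constructor <;> linarith

lemma abs_euclideanGram_le {a b c : ℝ} (hc : |a - b| ≤ c) (hc' : c ≤ a + b) :
    |euclideanGram a b c| ≤ a * b := by
  have hc0 := (abs_nonneg _).trans hc
  have upper : (a - b) ^ 2 ≤ c ^ 2 := sq_le_sq.2 (hc.trans (le_abs_self c))
  have lower : c ^ 2 ≤ (a + b) ^ 2 := by gcongr
  rw [euclideanGram, abs_le]
  constructor <;> linarith

lemma abs_hyperbolicGram_le {a b c : ℝ} (hc : |a - b| ≤ c) (hc' : c ≤ a + b) :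
    |hyperbolicGram a b c| ≤ Real.sinh a * Real.sinh b := by
  have hc0 := (abs_nonneg _).trans hc
  have upper : Real.cosh (a - b) ≤ Real.cosh c := Real.cosh_le_cosh.2 (hc.trans (le_abs_self c))
  have lower : Real.cosh c ≤ Real.cosh (a + b) := by
    rw [Real.cosh_le_cosh, abs_of_nonneg hc0, abs_of_nonneg (hc0.trans hc')]
    exact hc'
  rw [Real.cosh_sub] at upper
  rw [Real.cosh_add] at lower
  rw [hyperbolicGram, abs_le]
  constructor <;> linarith

lemma add_add_lt_two_pi_iff_of_pos {κ : ℝ} (hκ : 0 < κ) {a b c : ℝ} :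
    a + b + c < 2 * Real.pi / √κ ↔ √κ * a + √κ * b + √κ * c < 2 * Real.pi := by
  rw [lt_div_iff₀' (Real.sqrt_pos.2 hκ), mul_add, mul_add]

lemma abs_modelGram_le {κ a b c : ℝ} (hc : |a - b| ≤ c) (hc' : c ≤ a + b)
    (hper : 0 < κ → a + b + c < 2 * Real.pi / √κ) :
    |modelGram κ a b c| ≤ modelSin κ a * modelSin κ b := by
  have scale (k : ℝ) (hk : 0 ≤ k) : |k * a - k * b| ≤ k * c ∧ k * c ≤ k * a + k * b := by
    rw [← mul_sub, ← mul_add, abs_mul, abs_of_nonneg hk]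
    constructor <;> gcongr
  unfold modelGram modelSin
  split_ifs with hpos
  · exact abs_sphericalGram_le (scale _ (Real.sqrt_nonneg _)).1 (scale _ (Real.sqrt_nonneg _)).2
      ((add_add_lt_two_pi_iff_of_pos hpos).1 (hper hpos)).le
  · exact abs_hyperbolicGram_le (scale _ (Real.sqrt_nonneg _)).1 (scale _ (Real.sqrt_nonneg _)).2
  · exact abs_euclideanGram_le hc hc'

lemma modelSin_pos {κ a : ℝ} (ha : 0 < a) (hπ : 0 < κ → a < Real.pi / √κ) : 0 < modelSin κ a := by
  unfold modelSin
  split_ifs with hpos hneg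
  · have hk := Real.sqrt_pos.2 hpos
    exact Real.sin_pos_of_pos_of_lt_pi (by positivity) ((lt_div_iff₀' hk).1 (hπ hpos))
  · exact Real.sinh_pos_iff.2 (mul_pos (Real.sqrt_pos.2 (by linarith)) ha)
  · exact ha

lemma modelSin_zero (κ : ℝ) : modelSin κ 0 = 0 := by
  simp [modelSin]

end ModelKernels

section Comparison

variable {X : Type*} [MetricSpace X] {κ : ℝ}

/-- The perimeter of the triple `p, x, y` is less than the perimeter bound for curvature `κ`. -/
def SmallPerimeter (κ : ℝ) (p x y : X) : Prop :=
  0 < κ → dist p x + dist p y + dist x y < 2 * Real.pi / √κ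

lemma SmallPerimeter.symm {p x y : X} (h : SmallPerimeter κ p x y) : SmallPerimeter κ p y x := by
  intro hκ
  rw [add_comm (dist p y), dist_comm y]
  exact h hκ

lemma SmallPerimeter.self {p x y : X} (h : SmallPerimeter κ p x y) : SmallPerimeter κ p x x := by
  intro hκ
  rw [dist_self]
  linarith [h hκ, dist_triangle_right p x y]

lemma SmallPerimeter.dist_lt {p x : X} (h : SmallPerimeter κ p x x) (hκ : 0 < κ) :
    dist p x < Real.pi / √κ := by
  have := h hκ
  rw [dist_self, mul_div_assoc] at this
  linarith

lemma SmallPerimeter.modelSin_pos {p x : X} (h : SmallPerimeter κ p x x) (hpx : p ≠ x) :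
    0 < modelSin κ (dist p x) :=
  AlexandrovCBB.modelSin_pos (dist_pos.2 hpx) h.dist_lt

lemma SmallPerimeter.abs_gramAt_le {p x y : X} (h : SmallPerimeter κ p x y) :
    |gramAt (modelGram κ) p x y| ≤ modelSin κ (dist p x) * modelSin κ (dist p y) :=
  abs_modelGram_le (by simpa [dist_comm] using abs_dist_sub_le x y p) (dist_triangle_left x y p) h

lemma gramAt_modelGram_self (p x : X) :
    gramAt (modelGram κ) p x x = modelSin κ (dist p x) ^ 2 := by
  rw [gramAt, dist_self, modelGram_self]

lemma angleAt_eq_arccos (κ : ℝ) (p x y : X) : angleAt κ p x y =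
    Real.arccos (gramAt (modelGram κ) p x y /
      (modelSin κ (dist p x) * modelSin κ (dist p y))) :=
  modelAngle_eq_arccos _ _ _ _

/-- The angle comparison of `IsAlexandrovSpace`, expressed without angles: the Gram kernel of the
comparison directions at `p` is copositive. -/
def GramCopositive (κ : ℝ) (X : Type*) [MetricSpace X] : Prop :=
  ∀ (p : X) (x : Fin 3 → X), (∀ i j, SmallPerimeter κ p (x i) (x j)) →
    Copositive fun i j => gramAt (modelGram κ) p (x i) (x j)

lemma smallPerimeter_fin_three {p : X} {x : Fin 3 → X} (h01 : SmallPerimeter κ p (x 0) (x 1))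
    (h12 : SmallPerimeter κ p (x 1) (x 2)) (h20 : SmallPerimeter κ p (x 2) (x 0)) (i j : Fin 3) :
    SmallPerimeter κ p (x i) (x j) := by
  fin_cases i <;> fin_cases j
  exacts [h01.self, h01, h20.symm, h01.symm, h12.self, h12, h20, h12.symm, h20.self]

lemma IsAlexandrovSpace.gramCopositive (hX : IsAlexandrovSpace κ X) : GramCopositive κ X := by
  intro p x hper
  refine copositive_of_arccos_add_le (s := fun i => modelSin κ (dist p (x i)))
    (fun i j => gramAt_comm (modelGram_comm κ) _ _ _) (fun i => gramAt_modelGram_self p (x i))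
    (fun i j => (hper i j).abs_gramAt_le) (fun i => ?_) fun hpos => ?_
  · rcases eq_or_ne p (x i) with h | h
    · simp [← h, modelSin_zero]
    · exact ((hper i i).modelSin_pos h).le
  · have hne (i) : p ≠ x i := by
      intro h
      simpa [← h, modelSin_zero] using hpos i
    simp only [← angleAt_eq_arccos]
    exact hX.comparison p (x 0) (x 1) (x 2) ⟨hne 0, hne 1, hper 0 1⟩ ⟨hne 1, hne 2, hper 1 2⟩
      ⟨hne 2, hne 0, hper 2 0⟩

lemma GramCopositive.isAlexandrovSpace [CompleteSpace X] (hX : IsIntrinsic X)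
    (h : GramCopositive κ X) : IsAlexandrovSpace κ X := by
  refine ⟨‹_›, hX, fun p x y z hxy hyz hzx => ?_⟩
  have hper : ∀ i j, SmallPerimeter κ p (![x, y, z] i) (![x, y, z] j) :=
    smallPerimeter_fin_three hxy.2.2 hyz.2.2 hzx.2.2
  have hne (i : Fin 3) : p ≠ ![x, y, z] i := by
    fin_cases i
    exacts [hxy.1, hyz.1, hzx.1]
  have := (copositive_iff_arccos_add_le (fun i j => gramAt_comm (modelGram_comm κ) _ _ _)
    (fun i => gramAt_modelGram_self p (![x, y, z] i)) (fun i j => (hper i j).abs_gramAt_le)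
    fun i => (hper i i).modelSin_pos (hne i)).1 (h p ![x, y, z] hper)
  simp only [angleAt_eq_arccos]
  exact this

end Comparison

section Geodesics

/-- Any two points of `Y` are joined by a shortest path, parametrized on `[0, 1]` proportionally
to arc length. -/
def IsGeodesicSpace (Y : Type*) [PseudoMetricSpace Y] : Prop :=
  ∀ x y : Y, ∃ γ : ℝ → Y, γ 0 = x ∧ γ 1 = y ∧
    ∀ s ∈ Icc (0 : ℝ) 1, ∀ t ∈ Icc (0 : ℝ) 1, dist (γ s) (γ t) = |s - t| * dist x y

lemma edist_add_edist_add_edist_le_eVariationOn {α E : Type*} [LinearOrder α]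
    [PseudoEMetricSpace E] (f : α → E) {a b c d : α} (hab : a ≤ b) (hbc : b ≤ c) (hcd : c ≤ d) :
    edist (f a) (f b) + edist (f b) (f c) + edist (f c) (f d) ≤ eVariationOn f univ := by
  have edist_le {u v : α} (huv : u ≤ v) : edist (f u) (f v) ≤ eVariationOn f (univ ∩ Icc u v) :=
    eVariationOn.edist_le _ ⟨trivial, left_mem_Icc.2 huv⟩ ⟨trivial, right_mem_Icc.2 huv⟩
  calc _ ≤ eVariationOn f (univ ∩ Icc a b) + eVariationOn f (univ ∩ Icc b c) +
        eVariationOn f (univ ∩ Icc c d) := by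
        gcongr <;> exact edist_le ‹_›
    _ = eVariationOn f (univ ∩ Icc a d) := by
        rw [eVariationOn.Icc_add_Icc f hab hbc (mem_univ b),
          eVariationOn.Icc_add_Icc f (hab.trans hbc) hcd (mem_univ c)]
    _ ≤ eVariationOn f univ := eVariationOn.mono _ inter_subset_left

lemma exists_monotone_rightInverse_on_Icc {f : ℝ → ℝ} (hf : Continuous f) {L : ℝ} (hf0 : f 0 = 0)
    (hf1 : f 1 = L) (hL : 0 ≤ L) : ∃ τ : ℝ → ℝ, τ 1 = 1 ∧ MonotoneOn τ (Icc 0 1) ∧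
      ∀ t ∈ Icc (0 : ℝ) 1, τ t ∈ Icc (0 : ℝ) 1 ∧ f (τ t) = t * L := by
  have mul_mem {t : ℝ} (ht : t ∈ Icc (0 : ℝ) 1) : t * L ∈ Icc (f 0) (f 1) := by
    rw [hf0, hf1]
    exact ⟨mul_nonneg ht.1 hL, mul_le_of_le_one_left hL ht.2⟩
  have greatest (t : ℝ) (ht : t ∈ Icc (0 : ℝ) 1) :
      ∃ σ, IsGreatest (Icc (0 : ℝ) 1 ∩ {σ | f σ = t * L}) σ :=
    (isCompact_Icc.inter_right (isClosed_eq hf continuous_const)).exists_isGreatest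
      (intermediate_value_Icc zero_le_one hf.continuousOn (mul_mem ht))
  choose! τ hτ using greatest
  have h1 : (1 : ℝ) ∈ Icc (0 : ℝ) 1 := right_mem_Icc.2 zero_le_one
  refine ⟨τ, ?_, fun s hs t ht hst => ?_, fun t ht => (hτ t ht).1⟩
  · exact (hτ 1 h1).1.1.2.antisymm ((hτ 1 h1).2 ⟨h1, by simp [hf1]⟩)
  · obtain ⟨⟨hτs, hfs⟩, -⟩ := hτ s hs
    obtain ⟨σ, hσ, hfσ⟩ : t * L ∈ f '' Icc (τ s) 1 := by
      refine intermediate_value_Icc hτs.2 hf.continuousOn ⟨?_, (mul_mem ht).2⟩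
      rw [hfs]
      gcongr
    exact hσ.1.trans ((hτ t ht).2 ⟨⟨hτs.1.trans hσ.1, hσ.2⟩, hfσ⟩)

lemma IsIntrinsic.exists_path_dist_le {X : Type*} [MetricSpace X] (hX : IsIntrinsic X) (x y : X)
    {ε : ℝ} (hε : 0 < ε) : ∃ c : Path x y, ∀ a b : unitInterval, a ≤ b →
      dist x (c a) + dist (c a) (c b) + dist (c b) y ≤ dist x y + ε := by
  have hlt : (⨅ c : Path x y, eVariationOn (c : unitInterval → X) univ) <
      edist x y + ENNReal.ofReal ε := by
    rw [← hX x y]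
    exact ENNReal.lt_add_right (edist_ne_top _ _) (by simpa using hε)
  obtain ⟨c, hc⟩ := iInf_lt_iff.1 hlt
  refine ⟨c, fun a b hab => ?_⟩
  have hle := (edist_add_edist_add_edist_le_eVariationOn c unitInterval.nonneg' hab
    unitInterval.le_one').trans hc.le
  rw [c.source, c.target] at hle
  simp only [edist_dist] at hle
  rwa [← ENNReal.ofReal_add dist_nonneg dist_nonneg, ← ENNReal.ofReal_add (by positivity)
    dist_nonneg, ← ENNReal.ofReal_add dist_nonneg hε.le,
    ENNReal.ofReal_le_ofReal_iff (by positivity)] at hle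

lemma IsIntrinsic.exists_almost_geodesic {X : Type*} [MetricSpace X] (hX : IsIntrinsic X)
    (x y : X) {ε : ℝ} (hε : 0 < ε) : ∃ γ : ℝ → X, γ 0 = x ∧ γ 1 = y ∧
      ∀ s ∈ Icc (0 : ℝ) 1, ∀ t ∈ Icc (0 : ℝ) 1, |dist (γ s) (γ t) - |s - t| * dist x y| ≤ ε := by
  obtain ⟨c, hc⟩ := hX.exists_path_dist_le x y hε
  obtain ⟨τ, hτ1, hmono, hτ⟩ := exists_monotone_rightInverse_on_Icc
    (f := fun σ => dist x (c.extend σ)) (continuous_const.dist c.continuous_extend) (by simp)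
    (by simp) (dist_nonneg (x := x) (y := y))
  refine ⟨fun t => c.extend (τ t), ?_, by simp [hτ1], ?_⟩
  · simpa using (dist_eq_zero.1 ((hτ 0 (by simp)).2.trans (zero_mul _))).symm
  have ordered : ∀ s ∈ Icc (0 : ℝ) 1, ∀ t ∈ Icc (0 : ℝ) 1, s ≤ t →
      |dist (c.extend (τ s)) (c.extend (τ t)) - |s - t| * dist x y| ≤ ε := by
    intro s hs t ht hst
    have hlen := hc ⟨τ s, (hτ s hs).1⟩ ⟨τ t, (hτ t ht).1⟩ (hmono hs ht hst)
    rw [← c.extend_apply, ← c.extend_apply, (hτ s hs).2] at hlen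
    have hxs := dist_triangle x (c.extend (τ s)) (c.extend (τ t))
    have hty := dist_triangle x (c.extend (τ t)) y
    rw [(hτ t ht).2] at hxs hty
    rw [(hτ s hs).2] at hxs
    rw [abs_sub_comm s t, abs_of_nonneg (sub_nonneg.2 hst), abs_le]
    constructor <;> linarith
  intro s hs t ht
  rcases le_total s t with hst | hst
  · exact ordered s hs t ht hst
  · rw [dist_comm, abs_sub_comm s]
    exact ordered t ht s hs hst

end Geodesics

section Ultralimit

/-- The ultralimit of the constant sequence of spaces `k • X` (`X` with its metric multiplied by
`k`) along a nonprincipal ultrafilter, as the pseudometric space of bounded sequences. -/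
def Ultralimit (_ : ℝ≥0) (X : Type*) [MetricSpace X] : Type _ :=
  {u : ℕ → X // Bornology.IsBounded (range u)}

namespace Ultralimit

variable {k : ℝ≥0} {X : Type*} [MetricSpace X]

noncomputable instance : Dist (Ultralimit k X) where
  dist u v := limUnder (hyperfilter ℕ : Filter ℕ) fun n => k * dist (u.1 n) (v.1 n)

lemma tendsto_dist (u v : Ultralimit k X) :
    Tendsto (fun n => k * dist (u.1 n) (v.1 n)) (hyperfilter ℕ) (𝓝 (dist u v)) := by
  obtain ⟨M, hM⟩ := Metric.isBounded_iff.1 (u.2.union v.2)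
  obtain ⟨a, -, ha⟩ := (isCompact_Icc (a := 0) (b := M)).ultrafilter_le_nhds
    ((hyperfilter ℕ).map fun n => dist (u.1 n) (v.1 n)) (by
      rw [le_principal_iff]
      exact mem_map.2 (univ_mem' fun n => ⟨dist_nonneg, hM (Or.inl ⟨n, rfl⟩) (Or.inr ⟨n, rfl⟩)⟩))
  exact tendsto_nhds_limUnder ⟨k * a, Tendsto.const_mul (k : ℝ) (show Tendsto _ _ _ from ha)⟩

lemma dist_eq {u v : Ultralimit k X} {a : ℝ}
    (h : Tendsto (fun n => k * dist (u.1 n) (v.1 n)) (hyperfilter ℕ) (𝓝 a)) : dist u v = a :=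
  tendsto_nhds_unique (tendsto_dist u v) h

noncomputable instance : PseudoMetricSpace (Ultralimit k X) where
  dist_self u := dist_eq (by simp)
  dist_comm u v := dist_eq (by simpa only [dist_comm] using tendsto_dist v u)
  dist_triangle u v w := le_of_tendsto_of_tendsto' (tendsto_dist u w)
    ((tendsto_dist u v).add (tendsto_dist v w)) fun n => by
      rw [← mul_add]
      exact mul_le_mul_of_nonneg_left (dist_triangle _ _ _) k.2

/-- The point represented by a constant sequence. -/
def const (k : ℝ≥0) (x : X) : Ultralimit k X :=
  ⟨fun _ => x, Bornology.isBounded_singleton.subset range_const_subset⟩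

lemma dist_const (x y : X) : dist (const k x) (const k y) = k * dist x y :=
  dist_eq tendsto_const_nhds

lemma gramAt_const (G : ℝ → ℝ → ℝ → ℝ) (p x y : X) :
    gramAt G (const k p) (const k x) (const k y) =
      gramAt (fun a b c => G (k * a) (k * b) (k * c)) p x y := by
  simp only [gramAt, dist_const]

lemma tendsto_gramAt {G : ℝ → ℝ → ℝ → ℝ} (hG : Continuous fun v : ℝ × ℝ × ℝ => G v.1 v.2.1 v.2.2)
    (p u v : Ultralimit k X) :
    Tendsto (fun n => G (k * dist (p.1 n) (u.1 n)) (k * dist (p.1 n) (v.1 n))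
      (k * dist (u.1 n) (v.1 n))) (hyperfilter ℕ) (𝓝 (gramAt G p u v)) :=
  (hG.tendsto (dist p u, dist p v, dist u v)).comp
    ((tendsto_dist p u).prodMk_nhds ((tendsto_dist p v).prodMk_nhds (tendsto_dist u v)))

lemma isBounded_range_of_dist_le (u : Ultralimit k X) {v : ℕ → X} {M : ℝ}
    (h : ∀ n, dist (u.1 n) (v n) ≤ M) : Bornology.IsBounded (range v) := by
  obtain ⟨C, hC⟩ := Metric.isBounded_iff.1 u.2
  refine Metric.isBounded_iff.2 ⟨M + C + M, ?_⟩
  rintro _ ⟨n, rfl⟩ _ ⟨m, rfl⟩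
  have htri := dist_triangle4 (v n) (u.1 n) (u.1 m) (v m)
  rw [dist_comm (v n) (u.1 n)] at htri
  have hnm := hC ⟨n, rfl⟩ ⟨m, rfl⟩
  linarith [h n, h m]

lemma isGeodesicSpace (hX : IsIntrinsic X) (k : ℝ≥0) : IsGeodesicSpace (Ultralimit k X) := by
  intro u v
  choose γ hγ0 hγ1 hγ using fun n : ℕ =>
    hX.exists_almost_geodesic (u.1 n) (v.1 n) (Nat.one_div_pos_of_nat (α := ℝ) (n := n))
  obtain ⟨M, hM⟩ := Metric.isBounded_iff.1 (u.2.union v.2)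
  have hbdd (t : ℝ) (ht : t ∈ Icc (0 : ℝ) 1) : Bornology.IsBounded (range fun n => γ n t) := by
    refine u.isBounded_range_of_dist_le (M := M + 1) fun n => ?_
    have herr := (abs_le.1 (hγ n 0 (by simp) t ht)).2
    rw [hγ0, zero_sub, abs_neg, abs_of_nonneg ht.1] at herr
    have hle : t * dist (u.1 n) (v.1 n) ≤ M :=
      (mul_le_of_le_one_left dist_nonneg ht.2).trans (hM (Or.inl ⟨n, rfl⟩) (Or.inr ⟨n, rfl⟩))
    have hn : 1 / ((n : ℝ) + 1) ≤ 1 := div_le_one_of_le₀ (by simp) (by positivity)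
    linarith
  refine ⟨fun t => ⟨fun n => γ n (projIcc 0 1 zero_le_one t),
    hbdd _ (projIcc 0 1 zero_le_one t).2⟩, Subtype.ext (funext fun n => by simp [hγ0]),
    Subtype.ext (funext fun n => by simp [hγ1]), fun s hs t ht => dist_eq ?_⟩
  simp only [projIcc_of_mem zero_le_one hs, projIcc_of_mem zero_le_one ht]
  refine tendsto_of_tendsto_of_dist ((tendsto_dist u v).const_mul |s - t|)
    (squeeze_zero (fun _ => dist_nonneg) (fun n => ?_)
      ((mul_zero (k : ℝ)) ▸ (tendsto_one_div_add_atTop_nhds_zero_nat.mono_left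
        Nat.hyperfilter_le_atTop).const_mul (k : ℝ)))
  rw [dist_comm, Real.dist_eq, mul_left_comm, ← mul_sub, abs_mul, NNReal.abs_eq]
  exact mul_le_mul_of_nonneg_left (hγ n s hs t ht) k.2

end Ultralimit

end Ultralimit

section MaximumPrinciple

lemma nonpos_of_midpoint_le {D ψ : ℝ → ℝ} {L : ℝ} (hD : ContinuousOn D (Icc 0 L))
    (hψ : ContinuousOn ψ (Icc 0 L)) (hψpos : ∀ t ∈ Icc 0 L, 0 < ψ t) (h0 : D 0 ≤ 0) (hL : D L ≤ 0)
    (hmid : ∀ t ∈ Ioo 0 L, ∃ h > 0, ∃ C : ℝ, 0 ≤ t - h ∧ t + h ≤ L ∧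
      C * D t ≤ D (t - h) + D (t + h) ∧ ψ (t - h) + ψ (t + h) = C * ψ t) :
    ∀ t ∈ Icc 0 L, D t ≤ 0 := by
  intro t ht
  by_contra! hpos
  have hq : ContinuousOn (fun t => D t / ψ t) (Icc 0 L) := hD.div hψ fun t ht => (hψpos t ht).ne'
  obtain ⟨m, hm, hmax⟩ := isCompact_Icc.exists_isMaxOn ⟨t, ht⟩ hq
  set M := D m / ψ m
  have hM : 0 < M := (div_pos hpos (hψpos t ht)).trans_le (hmax ht)
  have le_mul {s : ℝ} (hs : s ∈ Icc 0 L) : D s ≤ M * ψ s := (div_le_iff₀ (hψpos s hs)).1 (hmax hs)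
  obtain ⟨r, ⟨hr, hrM⟩, hleast⟩ : ∃ r, IsLeast (Icc 0 L ∩ (fun t => D t / ψ t) ⁻¹' {M}) r :=
    (isCompact_Icc.of_isClosed_subset (hq.preimage_isClosed_of_isClosed isClosed_Icc
      isClosed_singleton) inter_subset_left).exists_isLeast ⟨m, hm, rfl⟩
  have hDr : D r = M * ψ r := (div_eq_iff (hψpos r hr).ne').1 hrM
  have hDr0 : 0 < D r := hDr ▸ mul_pos hM (hψpos r hr)
  have hr0 : 0 < r := hr.1.lt_of_ne (by rintro rfl; exact h0.not_gt hDr0)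
  have hrL : r < L := hr.2.lt_of_ne (by rintro rfl; exact hL.not_gt hDr0)
  obtain ⟨h, hh, C, hl, hu, hle, heq⟩ := hmid r ⟨hr0, hrL⟩
  have hleft : r - h ∈ Icc 0 L := ⟨hl, by linarith⟩
  have hlt : D (r - h) < M * ψ (r - h) := by
    refine (le_mul hleft).lt_of_ne fun h' => ?_
    have := hleast ⟨hleft, (div_eq_iff (hψpos _ hleft).ne').2 h'⟩
    linarith
  have hright := le_mul (s := r + h) ⟨by linarith, hu⟩
  have : C * D r = M * ψ (r - h) + M * ψ (r + h) := by
    rw [← mul_add, heq, hDr]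
    ring
  linarith

/-- The common part of the trigonometry of the model planes: `sn` and `cs` solve
`u'' = -κ u` with `sn 0 = 0`, here in the form of the finite difference equation. -/
structure IsModelTrig (sn cs : ℝ → ℝ) : Prop where
  continuous_sn : Continuous sn
  continuous_cs : Continuous cs
  sn_zero : sn 0 = 0
  sn_sub_add : ∀ t h, sn (t - h) + sn (t + h) = 2 * cs h * sn t
  cs_sub_add : ∀ t h, cs (t - h) + cs (t + h) = 2 * cs h * cs t

lemma isModelTrig_sin_cos : IsModelTrig Real.sin Real.cos where
  continuous_sn := Real.continuous_sin
  continuous_cs := Real.continuous_cos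
  sn_zero := Real.sin_zero
  sn_sub_add t h := by rw [Real.sin_sub, Real.sin_add]; ring
  cs_sub_add t h := by rw [Real.cos_sub, Real.cos_add]; ring

lemma isModelTrig_sinh_cosh : IsModelTrig Real.sinh Real.cosh where
  continuous_sn := Real.continuous_sinh
  continuous_cs := Real.continuous_cosh
  sn_zero := Real.sinh_zero
  sn_sub_add t h := by rw [Real.sinh_sub, Real.sinh_add]; ring
  cs_sub_add t h := by rw [Real.cosh_sub, Real.cosh_add]; ring

lemma isModelTrig_id_one : IsModelTrig id 1 where
  continuous_sn := continuous_id
  continuous_cs := continuous_one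
  sn_zero := rfl
  sn_sub_add t h := by simp only [id, Pi.one_apply]; ring
  cs_sub_add t h := by simp only [Pi.one_apply]; ring

-- Sturm comparison: `φ` is a subsolution of the equation solved by `sn`, so `φ / sn` increases.
lemma IsModelTrig.sn_mul_le_sn_mul {sn cs : ℝ → ℝ} (htrig : IsModelTrig sn cs) {φ : ℝ → ℝ} {L : ℝ}
    (hφ : ContinuousOn φ (Icc 0 L)) (hφ0 : φ 0 = 0) (hsn : 0 ≤ sn L)
    (hcs : ∀ t ∈ Icc (-(L / 2)) (L / 2), 0 < cs t)
    (hmid : ∀ t ∈ Ioo 0 L, ∃ h > 0, 0 ≤ t - h ∧ t + h ≤ L ∧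
      2 * cs h * φ t ≤ φ (t - h) + φ (t + h)) :
    ∀ t ∈ Icc 0 L, sn L * φ t ≤ sn t * φ L := by
  suffices ∀ t ∈ Icc 0 L, sn L * φ t - sn t * φ L ≤ 0 by simpa only [sub_nonpos] using this
  refine nonpos_of_midpoint_le (ψ := fun t => cs (t - L / 2))
    ((hφ.const_mul _).sub (htrig.continuous_sn.continuousOn.mul_const _))
    (htrig.continuous_cs.comp (continuous_id.sub continuous_const)).continuousOn
    (fun t ht => hcs _ ⟨by linarith [ht.1], by linarith [ht.2]⟩)
    (by simp [hφ0, htrig.sn_zero]) (by simp) fun t ht => ?_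
  obtain ⟨h, hh, hl, hu, hle⟩ := hmid t ht
  refine ⟨h, hh, 2 * cs h, hl, hu, ?_, ?_⟩
  · have := mul_le_mul_of_nonneg_left hle hsn
    linear_combination this + φ L * htrig.sn_sub_add t h
  · rw [← htrig.cs_sub_add, sub_right_comm, add_sub_right_comm]

end MaximumPrinciple

section UnitSpeed

variable {Y : Type*} [PseudoMetricSpace Y]

/-- `γ` is a shortest path on `[0, L]`, parametrized by arc length. -/
def IsUnitSpeed (γ : ℝ → Y) (L : ℝ) : Prop :=
  ∀ s ∈ Icc 0 L, ∀ t ∈ Icc 0 L, dist (γ s) (γ t) = |s - t|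

lemma IsUnitSpeed.dist_eq {γ : ℝ → Y} {L s t : ℝ} (hγ : IsUnitSpeed γ L) (hs : 0 ≤ s)
    (hst : s ≤ t) (ht : t ≤ L) : dist (γ s) (γ t) = t - s := by
  rw [hγ s ⟨hs, hst.trans ht⟩ t ⟨hs.trans hst, ht⟩, abs_sub_comm, abs_of_nonneg (sub_nonneg.2 hst)]

lemma IsUnitSpeed.continuousOn {γ : ℝ → Y} {L : ℝ} (hγ : IsUnitSpeed γ L) :
    ContinuousOn γ (Icc 0 L) :=
  (LipschitzOnWith.of_dist_le_mul (K := 1) fun s hs t ht => by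
    rw [hγ s hs t ht, Real.dist_eq, NNReal.coe_one, one_mul]).continuousOn

lemma IsGeodesicSpace.exists_isUnitSpeed (hY : IsGeodesicSpace Y) {x y : Y} (hxy : 0 < dist x y) :
    ∃ γ : ℝ → Y, γ 0 = x ∧ γ (dist x y) = y ∧ IsUnitSpeed γ (dist x y) := by
  obtain ⟨γ, hγ0, hγ1, hγ⟩ := hY x y
  have mem_unit {t : ℝ} (ht : t ∈ Icc 0 (dist x y)) : t / dist x y ∈ Icc (0 : ℝ) 1 :=
    ⟨div_nonneg ht.1 hxy.le, (div_le_one hxy).2 ht.2⟩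
  refine ⟨fun t => γ (t / dist x y), by simp [hγ0], by simp [hγ1, hxy.ne'], fun s hs t ht => ?_⟩
  rw [hγ _ (mem_unit hs) _ (mem_unit ht), ← sub_div, abs_div, abs_of_pos hxy,
    div_mul_cancel₀ _ hxy.ne']

lemma IsGeodesicSpace.exists_dist_eq (hY : IsGeodesicSpace Y) {x y : Y} {t : ℝ} (ht : 0 ≤ t)
    (ht' : t ≤ dist x y) : ∃ z, dist x z = t ∧ dist z y = dist x y - t := by
  rcases (dist_nonneg (x := x) (y := y)).eq_or_lt with h | h
  · obtain rfl : t = 0 := by linarith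
    exact ⟨x, by simp⟩
  · obtain ⟨γ, hγ0, hγL, hγ⟩ := hY.exists_isUnitSpeed h
    refine ⟨γ t, ?_, ?_⟩
    · simpa [hγ0] using hγ.dist_eq le_rfl ht ht'
    · simpa [hγL] using hγ.dist_eq ht ht' le_rfl

end UnitSpeed

section MidpointInequalities

lemma nonpos_of_forall_le_mul_of_contracting {α : Type*} {e σ : α → ℝ} {A : Set α} {q K₀ : ℝ}
    (hq : q ∈ Ico (0 : ℝ) 1) (hK₀ : 0 ≤ K₀) (hbase : ∀ w ∈ A, e w ≤ K₀ * σ w)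
    (hstep : ∀ K ∈ Icc 0 K₀, (∀ w ∈ A, e w ≤ K * σ w) → ∀ w ∈ A, e w ≤ q * K * σ w) :
    ∀ w ∈ A, e w ≤ 0 := by
  have bound (n : ℕ) : ∀ w ∈ A, e w ≤ q ^ n * K₀ * σ w := by
    induction n with
    | zero => simpa using hbase
    | succ n ih =>
      have hK : q ^ n * K₀ ∈ Icc 0 K₀ := ⟨mul_nonneg (pow_nonneg hq.1 n) hK₀,
        mul_le_of_le_one_left hK₀ (pow_le_one₀ hq.1 hq.2.le)⟩
      simpa only [pow_succ', mul_assoc] using hstep _ hK ih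
  intro w hw
  have lim : Tendsto (fun n : ℕ => q ^ n * K₀ * σ w) atTop (𝓝 (0 * K₀ * σ w)) :=
    ((tendsto_pow_atTop_nhds_zero_of_lt_one hq.1 hq.2).mul_const _).mul_const _
  rw [zero_mul, zero_mul] at lim
  exact ge_of_tendsto' lim fun n => bound n w hw

variable {Y : Type*} [PseudoMetricSpace Y]

/-- The quadruple inequality belonging to the Gram kernel `G`: for each of the three kernels it is
the inequality of the theorem, with all terms moved to one side. -/
def GramSumNonneg (G : ℝ → ℝ → ℝ → ℝ) (Y : Type*) [PseudoMetricSpace Y] : Prop :=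
  ∀ (p : Y) (x : Fin 3 → Y), 0 ≤ ∑ i, ∑ j, gramAt G p (x i) (x j)

lemma GramSumNonneg.euclidean (hG : GramSumNonneg euclideanGram Y) (p x y z : Y) :
    dist x y ^ 2 + dist y z ^ 2 + dist x z ^ 2 ≤
      3 * (dist p x ^ 2 + dist p y ^ 2 + dist p z ^ 2) := by
  have := hG p ![x, y, z]
  simp only [Fin.sum_univ_three, gramAt, euclideanGram, Matrix.cons_val, dist_self, dist_comm y x,
    dist_comm z] at this
  linarith

lemma GramSumNonneg.hyperbolic (hG : GramSumNonneg hyperbolicGram Y) (p x y z : Y) :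
    3 + 2 * (Real.cosh (dist x y) + Real.cosh (dist y z) + Real.cosh (dist x z)) ≤
      (Real.cosh (dist p x) + Real.cosh (dist p y) + Real.cosh (dist p z)) ^ 2 := by
  have := hG p ![x, y, z]
  simp only [Fin.sum_univ_three, gramAt, hyperbolicGram, Matrix.cons_val, dist_self,
    Real.cosh_zero, dist_comm y x, dist_comm z] at this
  linarith

lemma GramSumNonneg.spherical (hG : GramSumNonneg sphericalGram Y) (p x y z : Y) :
    (Real.cos (dist p x) + Real.cos (dist p y) + Real.cos (dist p z)) ^ 2 ≤
      3 + 2 * (Real.cos (dist x y) + Real.cos (dist y z) + Real.cos (dist x z)) := by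
  have := hG p ![x, y, z]
  simp only [Fin.sum_univ_three, gramAt, sphericalGram, Matrix.cons_val, dist_self,
    Real.cos_zero, dist_comm y x, dist_comm z] at this
  linarith

-- The quadruple inequality at the centroid of `x`, `y`, `w`, which lies on the geodesic from the
-- midpoint `z` to `w`, improves an approximate median inequality.
lemma IsGeodesicSpace.euclidean_midpoint (hY : IsGeodesicSpace Y)
    (hG : GramSumNonneg euclideanGram Y) {x y z : Y} {t : ℝ} (hxz : dist x z = t)
    (hyz : dist y z = t) (hxy : dist x y = 2 * t) (w : Y) :
    dist x w ^ 2 + dist y w ^ 2 ≤ 2 * t ^ 2 + 2 * dist z w ^ 2 := by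
  refine sub_nonpos.1 (nonpos_of_forall_le_mul_of_contracting
    (e := fun w => dist x w ^ 2 + dist y w ^ 2 - (2 * t ^ 2 + 2 * dist z w ^ 2))
    (σ := fun w => dist z w ^ 2) (A := univ) (q := 1 / 3) (K₀ := 1)
    (by norm_num) zero_le_one (fun w _ => ?_) (fun K _ ih w _ => ?_) w trivial)
  · have := hG.euclidean z x y w
    rw [dist_comm z x, dist_comm z y, hxz, hyz, hxy] at this
    linarith
  · have hs : 0 ≤ dist z w := dist_nonneg
    obtain ⟨v, hzv, hvw⟩ := hY.exists_dist_eq (x := z) (y := w) (t := dist z w / 3)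
      (by linarith) (by linarith)
    have at_v := ih v trivial
    have quad := hG.euclidean v x y w
    rw [dist_comm v x, dist_comm v y, hxy, hvw] at quad
    rw [hzv] at at_v
    linarith

-- In the hyperboloid model, `N` is the norm of `2T z + w = x + y + w` and `s'` the distance from
-- `z` of its direction.
lemma exists_hyperbolic_centroid {T s : ℝ} (hT : 1 ≤ T) (hs : 0 ≤ s) :
    ∃ N, 3 ≤ N ∧ N ^ 2 = 4 * T ^ 2 + 1 + 4 * T * Real.cosh s ∧ ∃ s' ∈ Icc 0 s,
      Real.sinh s' = Real.sinh s / N ∧ 2 * T * Real.cosh s' + Real.cosh (s - s') = N := by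
  set C := Real.cosh s
  set S := Real.sinh s
  have hC : 1 ≤ C := Real.one_le_cosh s
  have hS : 0 ≤ S := Real.sinh_nonneg_iff.2 hs
  have hCS : C ^ 2 = S ^ 2 + 1 := Real.cosh_sq s
  have hTC : 1 ≤ T * C := one_le_mul_of_one_le_of_one_le hT hC
  set N := √(4 * T ^ 2 + 1 + 4 * T * C)
  have hN2 : N ^ 2 = 4 * T ^ 2 + 1 + 4 * T * C := Real.sq_sqrt (by nlinarith)
  have hN3 : 3 ≤ N := Real.le_sqrt_of_sq_le (by nlinarith)
  have : 0 < N := by linarith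
  have hsinh : Real.sinh (Real.arsinh (S / N)) = S / N := Real.sinh_arsinh _
  have hcosh : Real.cosh (Real.arsinh (S / N)) = (2 * T + C) / N := by
    refine (sq_eq_sq₀ (Real.cosh_pos _).le (by positivity)).1 ?_
    rw [Real.cosh_sq, hsinh, div_pow, div_pow, div_add_one (by positivity), hN2]
    congr 1
    linear_combination -hCS
  refine ⟨N, hN3, hN2, Real.arsinh (S / N), ⟨Real.arsinh_nonneg_iff.2 (by positivity), ?_⟩,
    hsinh, ?_⟩
  · rw [← Real.sinh_le_sinh, hsinh]
    exact div_le_self hS (by linarith)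
  · rw [Real.cosh_sub, hsinh, hcosh]
    field_simp
    linear_combination hCS - hN2

lemma sq_add_mul_div_sq_le {N S C K : ℝ} (hN : 3 ≤ N) (hNC : 4 * C ≤ N ^ 2) (hC : 0 ≤ C)
    (hSC : S ^ 2 ≤ C ^ 2) (hK : K ∈ Icc (0 : ℝ) (1 / 2)) :
    (N + K * (S / N) ^ 2) ^ 2 ≤ N ^ 2 + K * S ^ 2 := by
  have : 0 < N := by linarith
  have linear_term : 2 * N * (K * (S / N) ^ 2) ≤ 2 / 3 * (K * S ^ 2) := by
    calc 2 * N * (K * (S / N) ^ 2) = 2 / N * (K * S ^ 2) := by field_simp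
      _ ≤ 2 / 3 * (K * S ^ 2) := by
          have := hK.1
          gcongr
  have hSN : 16 * S ^ 2 ≤ N ^ 4 := by nlinarith
  have quadratic_term : (K * (S / N) ^ 2) ^ 2 ≤ 1 / 3 * (K * S ^ 2) := by
    calc (K * (S / N) ^ 2) ^ 2 = K * (S ^ 2 / N ^ 4) * (K * S ^ 2) := by field_simp
      _ ≤ 1 / 2 * (1 / 16) * (K * S ^ 2) := by
          have := hK.1
          have : S ^ 2 / N ^ 4 ≤ 1 / 16 := (div_le_iff₀ (by positivity)).2 (by linarith)
          have := hK.2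
          gcongr
      _ ≤ 1 / 3 * (K * S ^ 2) := by
          have := hK.1
          gcongr
          norm_num
  linarith

lemma IsGeodesicSpace.hyperbolic_midpoint_step (hY : IsGeodesicSpace Y)
    (hG : GramSumNonneg hyperbolicGram Y) {x y z : Y} {t K : ℝ} (hxy : dist x y = 2 * t)
    (hK : K ∈ Icc (0 : ℝ) (1 / 2))
    (hbound : ∀ w, Real.cosh (dist x w) + Real.cosh (dist y w) ≤
      2 * Real.cosh t * Real.cosh (dist z w) + K * Real.sinh (dist z w) ^ 2) (w : Y) :
    Real.cosh (dist x w) + Real.cosh (dist y w) ≤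
      2 * Real.cosh t * Real.cosh (dist z w) + 1 / 2 * K * Real.sinh (dist z w) ^ 2 := by
  obtain ⟨N, hN3, hN2, s', ⟨hs'0, hs's⟩, hsinh, hN⟩ :=
    exists_hyperbolic_centroid (Real.one_le_cosh t) (dist_nonneg (x := z) (y := w))
  obtain ⟨v, hzv, hvw⟩ := hY.exists_dist_eq hs'0 hs's
  have at_v := hbound v
  rw [hzv, hsinh] at at_v
  have quad := hG.hyperbolic v x y w
  rw [dist_comm v x, dist_comm v y, hxy, hvw, Real.cosh_two_mul, Real.sinh_sq] at quad
  have sum_le : Real.cosh (dist x v) + Real.cosh (dist y v) + Real.cosh (dist z w - s') ≤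
      N + K * (Real.sinh (dist z w) / N) ^ 2 := by linarith
  have sq_le := (pow_le_pow_left₀ (by positivity) sum_le 2).trans
    (sq_add_mul_div_sq_le (C := Real.cosh (dist z w)) hN3
      (by nlinarith [Real.one_le_cosh t, Real.one_le_cosh (dist z w)]) (by positivity)
      (by rw [Real.cosh_sq]; linarith) hK)
  linarith

lemma IsGeodesicSpace.hyperbolic_midpoint (hY : IsGeodesicSpace Y)
    (hG : GramSumNonneg hyperbolicGram Y) {x y z : Y} {t : ℝ} (hxz : dist x z = t)
    (hyz : dist y z = t) (hxy : dist x y = 2 * t) (w : Y) :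
    Real.cosh (dist x w) + Real.cosh (dist y w) ≤ 2 * Real.cosh t * Real.cosh (dist z w) := by
  refine sub_nonpos.1 (nonpos_of_forall_le_mul_of_contracting
    (e := fun w => Real.cosh (dist x w) + Real.cosh (dist y w) -
      2 * Real.cosh t * Real.cosh (dist z w))
    (σ := fun w => Real.sinh (dist z w) ^ 2) (A := univ) (q := 1 / 2) (K₀ := 1 / 2)
    (by norm_num) (by norm_num) (fun w _ => ?_) (fun K hK ih w _ => ?_) w trivial)
  · have := hG.hyperbolic z x y w
    rw [dist_comm z x, dist_comm z y, hxz, hyz, hxy, Real.cosh_two_mul, Real.sinh_sq] at this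
    rw [Real.sinh_sq]
    linarith
  · simp only [sub_le_iff_le_add'] at ih ⊢
    exact hY.hyperbolic_midpoint_step hG hxy hK (fun w => ih w trivial) w

lemma exists_spherical_centroid {T s : ℝ} (hT : 0 < T) (hTs : 0 < T + Real.cos s)
    (hs : s ∈ Icc 0 Real.pi) :
    ∃ s' ∈ Icc 0 s, Real.sin s' = Real.sin s / √(1 + 4 * T * (T + Real.cos s)) ∧
      2 * T * Real.cos s' + Real.cos (s - s') = √(1 + 4 * T * (T + Real.cos s)) := by
  set C := Real.cos s
  set S := Real.sin s
  have hS : 0 ≤ S := Real.sin_nonneg_of_nonneg_of_le_pi hs.1 hs.2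
  have hCS : S ^ 2 + C ^ 2 = 1 := Real.sin_sq_add_cos_sq s
  set N := √(1 + 4 * T * (T + C))
  have hN2 : N ^ 2 = 1 + 4 * T * (T + C) := Real.sq_sqrt (by positivity)
  have hN : 0 < N := Real.sqrt_pos.2 (by positivity)
  have hTC : 0 ≤ 2 * T + C := by linarith
  have hsq : ((2 * T + C) / N) ^ 2 + (S / N) ^ 2 = 1 := by
    field_simp
    linear_combination hCS - hN2
  have hle : (2 * T + C) / N ≤ 1 :=
    (sq_le_one_iff₀ (by positivity)).1 (by linarith [sq_nonneg (S / N)])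
  have hcos : Real.cos (Real.arccos ((2 * T + C) / N)) = (2 * T + C) / N :=
    Real.cos_arccos (by linarith [div_nonneg hTC hN.le]) hle
  have hsin : Real.sin (Real.arccos ((2 * T + C) / N)) = S / N := by
    rw [Real.sin_arccos, ← hsq, add_sub_cancel_left, Real.sqrt_sq (by positivity)]
  refine ⟨_, ⟨Real.arccos_nonneg _, ?_⟩, hsin, ?_⟩
  · rw [← Real.arccos_cos hs.1 hs.2]
    refine Real.arccos_le_arccos ((le_div_iff₀ hN).2 ?_)
    rcases le_total C 0 with hC | hC
    · exact (mul_nonpos_of_nonpos_of_nonneg hC hN.le).trans hTC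
    · have hTC1 : T * C ≤ T := mul_le_of_le_one_right hT.le (Real.cos_le_one s)
      calc C * N ≤ C * (2 * T + 1) := by
            gcongr
            exact Real.sqrt_le_iff.2 ⟨by linarith, by linarith⟩
        _ ≤ 2 * T + C := by linarith
  · rw [Real.cos_sub, hsin, hcos]
    field_simp
    linear_combination hCS - hN2

lemma IsGeodesicSpace.spherical_midpoint_step (hY : IsGeodesicSpace Y)
    (hG : GramSumNonneg sphericalGram Y) {x y z w : Y} {t K : ℝ} (hxy : dist x y = 2 * t)
    (ht : 0 < Real.cos t) (hw : dist z w ≤ Real.pi) (htw : 0 < Real.cos t + Real.cos (dist z w))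
    (hbound : ∀ v, dist z v ≤ dist z w → 2 * Real.cos t * Real.cos (dist z v) ≤
      Real.cos (dist x v) + Real.cos (dist y v) + K * Real.sin (dist z v) ^ 2) :
    2 * Real.cos t * Real.cos (dist z w) ≤ Real.cos (dist x w) + Real.cos (dist y w) +
      1 / √(1 + 4 * Real.cos t * (Real.cos t + Real.cos (dist z w))) * K *
        Real.sin (dist z w) ^ 2 := by
  obtain ⟨s', ⟨hs'0, hs's⟩, hsin, hN⟩ := exists_spherical_centroid ht htw ⟨dist_nonneg, hw⟩
  obtain ⟨v, hzv, hvw⟩ := hY.exists_dist_eq hs'0 hs's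
  have at_v := hbound v (hzv.trans_le hs's)
  have quad := hG.spherical v x y w
  have hN2 := Real.sq_sqrt
    (show 0 ≤ 1 + 4 * Real.cos t * (Real.cos t + Real.cos (dist z w)) by positivity)
  have hN0 : 0 < √(1 + 4 * Real.cos t * (Real.cos t + Real.cos (dist z w))) :=
    Real.sqrt_pos.2 (by positivity)
  set N := √(1 + 4 * Real.cos t * (Real.cos t + Real.cos (dist z w)))
  rw [hzv, hsin] at at_v
  rw [dist_comm v x, dist_comm v y, hxy, hvw, Real.cos_two_mul] at quad
  set A := Real.cos (dist x v) + Real.cos (dist y v) + Real.cos (dist z w - s')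
  have hA : N * (N - A) ≤ 1 / N * K * Real.sin (dist z w) ^ 2 := by
    calc N * (N - A) ≤ N * (K * (Real.sin (dist z w) / N) ^ 2) := by
          gcongr
          linarith
      _ = 1 / N * K * Real.sin (dist z w) ^ 2 := by field_simp
  linarith [sq_nonneg (A - N)]

lemma IsGeodesicSpace.spherical_midpoint (hY : IsGeodesicSpace Y)
    (hG : GramSumNonneg sphericalGram Y) {x y z w : Y} {t : ℝ} (ht : t < Real.pi / 2)
    (hxz : dist x z = t) (hyz : dist y z = t) (hxy : dist x y = 2 * t)
    (hw : dist z w + t < Real.pi) :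
    2 * Real.cos t * Real.cos (dist z w) ≤ Real.cos (dist x w) + Real.cos (dist y w) := by
  have ht0 : 0 ≤ t := hxz ▸ dist_nonneg
  have hcos : 0 < Real.cos t := Real.cos_pos_of_mem_Ioo ⟨by linarith, ht⟩
  have hcos_add : 0 < Real.cos t + Real.cos (dist z w) := by
    have := Real.cos_lt_cos_of_nonneg_of_le_pi ht0 (sub_le_self _ dist_nonneg)
      (show t < Real.pi - dist z w by linarith)
    rw [Real.cos_pi_sub] at this
    linarith
  have one_lt : 1 < √(1 + 4 * Real.cos t * (Real.cos t + Real.cos (dist z w))) := by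
    rw [Real.lt_sqrt zero_le_one, one_pow]
    linarith [show 0 < 4 * Real.cos t * (Real.cos t + Real.cos (dist z w)) by positivity]
  refine sub_nonpos.1 (nonpos_of_forall_le_mul_of_contracting
    (e := fun w => 2 * Real.cos t * Real.cos (dist z w) -
      (Real.cos (dist x w) + Real.cos (dist y w)))
    (σ := fun w => Real.sin (dist z w) ^ 2) (A := {v | dist z v ≤ dist z w})
    (q := 1 / √(1 + 4 * Real.cos t * (Real.cos t + Real.cos (dist z w)))) (K₀ := 1 / 2)
    ⟨by positivity, (div_lt_one (by positivity)).2 one_lt⟩ (by norm_num)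
    (fun v _ => ?_) (fun K hK ih v hv => ?_) w (le_refl (dist z w)))
  · have := hG.spherical z x y v
    rw [dist_comm z x, dist_comm z y, hxz, hyz, hxy, Real.cos_two_mul] at this
    rw [Real.sin_sq]
    linarith
  · have hvw : Real.cos (dist z w) ≤ Real.cos (dist z v) :=
      Real.cos_le_cos_of_nonneg_of_le_pi dist_nonneg (by linarith) hv
    simp only [sub_le_iff_le_add'] at ih ⊢
    refine (hY.spherical_midpoint_step hG hxy hcos (by linarith [hv.out]) (by linarith)
      fun u hu => ih u (hu.trans hv)).trans ?_
    have := hK.1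
    gcongr

end MidpointInequalities

section RadialContraction

variable {Y : Type*} [PseudoMetricSpace Y]

lemma continuous_sphericalGram :
    Continuous fun v : ℝ × ℝ × ℝ => sphericalGram v.1 v.2.1 v.2.2 := by
  unfold sphericalGram
  fun_prop

lemma continuous_euclideanGram :
    Continuous fun v : ℝ × ℝ × ℝ => euclideanGram v.1 v.2.1 v.2.2 := by
  unfold euclideanGram
  fun_prop

lemma continuous_hyperbolicGram :
    Continuous fun v : ℝ × ℝ × ℝ => hyperbolicGram v.1 v.2.1 v.2.2 := by
  unfold hyperbolicGram
  fun_prop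

lemma gramAt_eq_zero_of_dist_eq_zero {G : ℝ → ℝ → ℝ → ℝ} (hG : ∀ b, G 0 b b = 0) {p x : Y}
    (hpx : dist p x = 0) (w : Y) : gramAt G p x w = 0 := by
  have : dist x w = dist p w := by
    linarith [dist_triangle p x w, dist_triangle_left x w p]
  rw [gramAt, hpx, this, hG]

lemma IsUnitSpeed.dist_sub_add {γ : ℝ → Y} {L t h : ℝ} (hγ : IsUnitSpeed γ L) (hh : 0 ≤ h)
    (hl : 0 ≤ t - h) (hu : t + h ≤ L) :
    dist (γ (t - h)) (γ t) = h ∧ dist (γ (t + h)) (γ t) = h ∧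
      dist (γ (t - h)) (γ (t + h)) = 2 * h := by
  rw [dist_comm (γ (t + h)), hγ.dist_eq hl (by linarith) (by linarith),
    hγ.dist_eq (by linarith) (by linarith) hu, hγ.dist_eq hl (by linarith) hu]
  refine ⟨?_, ?_, ?_⟩ <;> ring

lemma IsUnitSpeed.gramAt_eq {γ : ℝ → Y} {L t : ℝ} (hγ : IsUnitSpeed γ L) (G : ℝ → ℝ → ℝ → ℝ)
    {p : Y} (hp : γ 0 = p) (w : Y) (ht : 0 ≤ t) (htL : t ≤ L) :
    gramAt G p (γ t) w = G t (dist p w) (dist (γ t) w) := by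
  rw [gramAt, ← hp, hγ.dist_eq le_rfl ht htL, sub_zero]

lemma IsModelTrig.sn_mul_gramAt_le {sn cs : ℝ → ℝ} (htrig : IsModelTrig sn cs)
    {G : ℝ → ℝ → ℝ → ℝ} (hG : Continuous fun v : ℝ × ℝ × ℝ => G v.1 v.2.1 v.2.2)
    (hG0 : ∀ b, G 0 b b = 0) {γ : ℝ → Y} {L : ℝ} (hγ : IsUnitSpeed γ L) (hsn : 0 ≤ sn L)
    (hcs : ∀ t ∈ Icc (-(L / 2)) (L / 2), 0 < cs t) {p w : Y} (hp : γ 0 = p)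
    (hmid : ∃ h₀ > 0, ∀ t, ∀ h ∈ Ioo 0 h₀, 0 ≤ t - h → t + h ≤ L →
      2 * cs h * gramAt G p (γ t) w ≤ gramAt G p (γ (t - h)) w + gramAt G p (γ (t + h)) w) :
    ∀ t ∈ Icc 0 L, sn L * gramAt G p (γ t) w ≤ sn t * gramAt G p (γ L) w := by
  refine htrig.sn_mul_le_sn_mul (φ := fun t => gramAt G p (γ t) w) ?_
    (gramAt_eq_zero_of_dist_eq_zero hG0 (by rw [hp, dist_self]) w) hsn hcs fun t ht => ?_
  · have := hγ.continuousOn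
    exact hG.comp_continuousOn
      (show ContinuousOn (fun t => (dist p (γ t), dist p w, dist (γ t) w)) _ by fun_prop)
  · obtain ⟨h₀, hh₀, hle⟩ := hmid
    obtain ⟨h, hh, hlt⟩ := exists_between (lt_min hh₀ (lt_min ht.1 (sub_pos.2 ht.2)))
    obtain ⟨hlt₀, hlt₁, hlt₂⟩ : h < h₀ ∧ h < t ∧ h < L - t := by simpa only [lt_min_iff] using hlt
    exact ⟨h, hh, by linarith, by linarith, hle t h ⟨hh, hlt₀⟩ (by linarith) (by linarith)⟩

lemma IsModelTrig.exists_sn_eq {sn cs : ℝ → ℝ} (htrig : IsModelTrig sn cs) {L ρ : ℝ} (hL : 0 ≤ L)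
    (hsn : 0 ≤ sn L) (hρ : ρ ∈ Icc (0 : ℝ) 1) : ∃ s ∈ Icc 0 L, sn s = ρ * sn L := by
  have mem : ρ * sn L ∈ Icc (sn 0) (sn L) := by
    rw [htrig.sn_zero]
    exact ⟨mul_nonneg hρ.1 hsn, mul_le_of_le_one_left hsn hρ.2⟩
  exact intermediate_value_Icc hL htrig.continuous_sn.continuousOn mem

lemma IsGeodesicSpace.exists_contracts (hY : IsGeodesicSpace Y) {sn cs : ℝ → ℝ}
    (htrig : IsModelTrig sn cs) {G : ℝ → ℝ → ℝ → ℝ}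
    (hG : Continuous fun v : ℝ × ℝ × ℝ => G v.1 v.2.1 v.2.2) (hG0 : ∀ b, G 0 b b = 0)
    {R : Y → Y → Prop} {p x : Y}
    (hR : ∀ x' w, dist p x' + dist x' x = dist p x → R x w → R x' w)
    (hsn : 0 < dist p x → 0 < sn (dist p x))
    (hcs : ∀ t ∈ Icc (-(dist p x / 2)) (dist p x / 2), 0 < cs t)
    (hmid : ∀ γ : ℝ → Y, γ 0 = p → γ (dist p x) = x → IsUnitSpeed γ (dist p x) → ∀ w, R x w →
      ∃ h₀ > 0, ∀ t, ∀ h ∈ Ioo 0 h₀, 0 ≤ t - h → t + h ≤ dist p x →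
        2 * cs h * gramAt G p (γ t) w ≤ gramAt G p (γ (t - h)) w + gramAt G p (γ (t + h)) w)
    {ρ : ℝ} (hρ : ρ ∈ Icc (0 : ℝ) 1) : ∃ x', Contracts (gramAt G p) R ρ x x' := by
  rcases (dist_nonneg (x := p) (y := x)).eq_or_lt with hpx | hpx
  · refine ⟨x, fun w hw => ⟨?_, hw⟩⟩
    rw [gramAt_eq_zero_of_dist_eq_zero hG0 hpx.symm, mul_zero]
  · obtain ⟨γ, hγ0, hγL, hγ⟩ := hY.exists_isUnitSpeed hpx
    obtain ⟨s, hs, hsn_eq⟩ := htrig.exists_sn_eq hpx.le (hsn hpx).le hρ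
    refine ⟨γ s, fun w hw => ⟨?_, hR _ w ?_ hw⟩⟩
    · have := htrig.sn_mul_gramAt_le hG hG0 hγ (hsn hpx).le hcs hγ0 (hmid γ hγ0 hγL hγ w hw) s hs
      rw [hγL, hsn_eq, mul_right_comm, mul_comm] at this
      exact le_of_mul_le_mul_right this (hsn hpx)
    · have hps := hγ.dist_eq le_rfl hs.1 hs.2
      have hsx := hγ.dist_eq hs.1 hs.2 le_rfl
      rw [hγ0] at hps
      rw [hγL] at hsx
      linarith

lemma IsGeodesicSpace.copositive_euclideanGram (hY : IsGeodesicSpace Y)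
    (hG : GramSumNonneg euclideanGram Y) (p : Y) (x : Fin 3 → Y) :
    Copositive fun i j => gramAt euclideanGram p (x i) (x j) := by
  refine copositive_of_exists_contracts (R := fun _ _ => True) (gramAt_comm euclideanGram_comm p)
    (fun _ _ => id) (hG p) (fun _ _ => trivial) fun i ρ hρ => ?_
  refine hY.exists_contracts isModelTrig_id_one continuous_euclideanGram
    (fun b => by simp [euclideanGram]) (fun _ _ _ => id) id (fun _ _ => one_pos)
    (fun γ hp _ hγ w _ => ⟨1, one_pos, fun t h ⟨hh, _⟩ hl hu => ?_⟩) hρ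
  obtain ⟨h₁, h₂, h₁₂⟩ := hγ.dist_sub_add hh.le hl hu
  have hmid := hY.euclidean_midpoint hG h₁ h₂ h₁₂ w
  rw [hγ.gramAt_eq _ hp w hl (by linarith), hγ.gramAt_eq _ hp w (by linarith) hu,
    hγ.gramAt_eq _ hp w (by linarith) (by linarith)]
  simp only [euclideanGram, Pi.one_apply]
  linarith

lemma IsGeodesicSpace.copositive_hyperbolicGram (hY : IsGeodesicSpace Y)
    (hG : GramSumNonneg hyperbolicGram Y) (p : Y) (x : Fin 3 → Y) :
    Copositive fun i j => gramAt hyperbolicGram p (x i) (x j) := by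
  refine copositive_of_exists_contracts (R := fun _ _ => True) (gramAt_comm hyperbolicGram_comm p)
    (fun _ _ => id) (hG p) (fun _ _ => trivial) fun i ρ hρ => ?_
  refine hY.exists_contracts isModelTrig_sinh_cosh continuous_hyperbolicGram
    (fun b => by simp [hyperbolicGram]) (fun _ _ _ => id) Real.sinh_pos_iff.2
    (fun t _ => Real.cosh_pos t) (fun γ hp _ hγ w _ => ⟨1, one_pos, fun t h ⟨hh, _⟩ hl hu => ?_⟩) hρ
  obtain ⟨h₁, h₂, h₁₂⟩ := hγ.dist_sub_add hh.le hl hu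
  have hmid := hY.hyperbolic_midpoint hG h₁ h₂ h₁₂ w
  rw [hγ.gramAt_eq _ hp w hl (by linarith), hγ.gramAt_eq _ hp w (by linarith) hu,
    hγ.gramAt_eq _ hp w (by linarith) (by linarith)]
  simp only [hyperbolicGram]
  linear_combination hmid - Real.cosh (dist p w) * isModelTrig_sinh_cosh.cs_sub_add t h

lemma cos_pos_of_mem_Icc_of_lt_pi {L : ℝ} (hL : L < Real.pi) {t : ℝ}
    (ht : t ∈ Icc (-(L / 2)) (L / 2)) : 0 < Real.cos t :=
  Real.cos_pos_of_mem_Ioo ⟨by linarith [ht.1], by linarith [ht.2]⟩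

lemma IsGeodesicSpace.exists_contracts_sphericalGram (hY : IsGeodesicSpace Y)
    (hG : GramSumNonneg sphericalGram Y) {p x : Y} (hpx : dist p x < Real.pi) {ρ : ℝ}
    (hρ : ρ ∈ Icc (0 : ℝ) 1) : ∃ x', Contracts (gramAt sphericalGram p)
      (fun x w => dist p x + dist p w + dist x w < 2 * Real.pi) ρ x x' := by
  refine hY.exists_contracts isModelTrig_sin_cos continuous_sphericalGram
    (fun b => by simp [sphericalGram])
    (fun x' w hx' hw => by linarith [dist_triangle x' x w])
    (fun hpos => Real.sin_pos_of_pos_of_lt_pi hpos hpx) (fun t => cos_pos_of_mem_Icc_of_lt_pi hpx)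
    (fun γ hp hx hγ w hw => ?_) hρ
  refine ⟨min (Real.pi / 2) (Real.pi - (dist p x + dist p w + dist x w) / 2),
    lt_min (by positivity) (by linarith), fun t h ⟨hh, hh'⟩ hl hu => ?_⟩
  obtain ⟨hh₁, hh₂⟩ := lt_min_iff.1 hh'
  have dist_le : dist (γ t) w ≤ (dist p x + dist p w + dist x w) / 2 := by
    have hpt := hγ.dist_eq (s := 0) (t := t) le_rfl (by linarith) (by linarith)
    have htx := hγ.dist_eq (s := t) (t := dist p x) (by linarith) (by linarith) le_rfl
    rw [hp] at hpt
    rw [hx] at htx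
    linarith [dist_triangle_left (γ t) w p, dist_triangle (γ t) x w]
  obtain ⟨h₁, h₂, h₁₂⟩ := hγ.dist_sub_add hh.le hl hu
  have hmid := hY.spherical_midpoint hG hh₁ h₁ h₂ h₁₂ (w := w) (by linarith)
  rw [hγ.gramAt_eq _ hp w hl (by linarith), hγ.gramAt_eq _ hp w (by linarith) hu,
    hγ.gramAt_eq _ hp w (by linarith) (by linarith)]
  simp only [sphericalGram]
  linear_combination hmid + Real.cos (dist p w) * isModelTrig_sin_cos.cs_sub_add t h

/-- The comparison of `GramCopositive` for `κ = 1`, in pseudometric spaces. -/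
def SphericalCopositive (Y : Type*) [PseudoMetricSpace Y] : Prop :=
  ∀ (p : Y) (x : Fin 3 → Y),
    (∀ i j, dist p (x i) + dist p (x j) + dist (x i) (x j) < 2 * Real.pi) →
      Copositive fun i j => gramAt sphericalGram p (x i) (x j)

lemma IsGeodesicSpace.sphericalCopositive (hY : IsGeodesicSpace Y)
    (hG : GramSumNonneg sphericalGram Y) : SphericalCopositive Y := fun p x hper =>
  copositive_of_exists_contracts (gramAt_comm sphericalGram_comm p)
    (fun x y h => by rwa [add_comm (dist p y), dist_comm y]) (hG p) hper
    fun i _ hρ => hY.exists_contracts_sphericalGram hG (by linarith [hper i i, dist_self (x i)]) hρ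

end RadialContraction

section DiameterPi

variable {Y : Type*} [PseudoMetricSpace Y]

lemma gramAt_sphericalGram_self (p x : Y) :
    gramAt sphericalGram p x x = Real.sin (dist p x) ^ 2 := by
  rw [gramAt, sphericalGram, dist_self, Real.cos_zero, Real.sin_sq]
  ring

-- If the inequality fails by `K > 0`, the weights `sin b`, `sin a`, `K` of `x`, `y`, `w` at the
-- apex `z` violate copositivity: the contributions of `x` and `y` cancel because the directions
-- from `z` to `x` and `y` are opposite.
lemma SphericalCopositive.sin_add_mul_cos_dist_le (hW : SphericalCopositive Y) {x y z w : Y}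
    {a b : ℝ} (hxz : dist x z = a) (hzy : dist z y = b) (hxy : dist x y = a + b)
    (hab : a + b < Real.pi) (hw : dist x w + dist y w + (a + b) < 2 * Real.pi) :
    Real.sin (a + b) * Real.cos (dist z w) ≤
      Real.sin b * Real.cos (dist x w) + Real.sin a * Real.cos (dist y w) := by
  have ha : 0 ≤ a := hxz ▸ dist_nonneg
  have hb : 0 ≤ b := hzy ▸ dist_nonneg
  have hsa : 0 ≤ Real.sin a := Real.sin_nonneg_of_nonneg_of_le_pi ha (by linarith)
  have hsb : 0 ≤ Real.sin b := Real.sin_nonneg_of_nonneg_of_le_pi hb (by linarith)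
  rw [dist_comm] at hxz
  have hzw₁ := dist_triangle z x w
  have hzw₂ := dist_triangle z y w
  have hper : ∀ i j, dist z (![x, y, w] i) + dist z (![x, y, w] j) +
      dist (![x, y, w] i) (![x, y, w] j) < 2 * Real.pi := by
    intro i j
    fin_cases i <;> fin_cases j <;>
      simp only [Fin.zero_eta, Fin.mk_one, Fin.reduceFinMk, Matrix.cons_val, dist_self,
        dist_comm y x, dist_comm w] <;> linarith
  have hcop := (copositive_fin_three_iff (fun i j => gramAt_comm sphericalGram_comm z _ _)
    fun i => gramAt_sphericalGram_self z (![x, y, w] i)).1 (hW z ![x, y, w] hper)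
  by_contra! hlt
  have hform := hcop _ _ _ hsb hsa (sub_nonneg.2 hlt.le)
  simp only [Matrix.cons_val, gramAt, sphericalGram, hxz, hzy, hxy, dist_comm w x] at hform
  set K := Real.sin (a + b) * Real.cos (dist z w) -
    (Real.sin b * Real.cos (dist x w) + Real.sin a * Real.cos (dist y w)) with hK
  rw [Real.sin_add] at hK
  rw [Real.cos_add] at hform
  have hK0 : 0 < K ^ 2 := pow_pos (sub_pos.2 hlt) 2
  have hsin := mul_le_of_le_one_right hK0.le (Real.sin_sq_le_one (dist z w))
  linarith [show (Real.sin b * Real.sin a) ^ 2 + (Real.sin a * Real.sin b) ^ 2 +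
      (K * Real.sin (dist z w)) ^ 2 + 2 * (Real.sin b * Real.sin a * (Real.cos a * Real.cos b -
        Real.sin a * Real.sin b - Real.cos a * Real.cos b) + Real.sin a * K *
        (Real.cos (dist y w) - Real.cos b * Real.cos (dist z w)) + K * Real.sin b *
        (Real.cos (dist x w) - Real.cos (dist z w) * Real.cos a)) =
      K ^ 2 * Real.sin (dist z w) ^ 2 - 2 * K ^ 2 by linear_combination 2 * K * hK]

lemma SphericalCopositive.sin_mul_cos_dist_le_of_isUnitSpeed (hW : SphericalCopositive Y)
    {γ : ℝ → Y} {L s t : ℝ} (hγ : IsUnitSpeed γ L) (hs : 0 ≤ s) (hst : s ≤ t) (htL : t ≤ L)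
    (ht : t < Real.pi) {c : Y} (hper : dist (γ 0) c + t + dist (γ t) c < 2 * Real.pi) :
    Real.sin t * Real.cos (dist (γ s) c) ≤
      Real.sin (t - s) * Real.cos (dist (γ 0) c) + Real.sin s * Real.cos (dist (γ t) c) := by
  have := hW.sin_add_mul_cos_dist_le (x := γ 0) (z := γ s) (y := γ t) (w := c) (a := s) (b := t - s)
    (by rw [hγ.dist_eq le_rfl hs (hst.trans htL), sub_zero]) (hγ.dist_eq hs hst htL)
    (by rw [hγ.dist_eq le_rfl (hs.trans hst) htL]; ring) (by linarith) (by linarith)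
  rwa [add_sub_cancel] at this

lemma dist_eq_pi_of_cos_le {x c : Y} (hd : dist x c ≤ Real.pi) (h : Real.cos (dist x c) ≤ -1) :
    dist x c = Real.pi := by
  refine Real.injOn_cos ⟨dist_nonneg, hd⟩ ⟨Real.pi_nonneg, le_rfl⟩ ?_
  rw [Real.cos_pi]
  exact h.antisymm (Real.neg_one_le_cos _)

-- In the limit of perimeter `2π` the comparison triangle becomes a great circle, so that the
-- point of the side opposite to `c` is the antipode of `c`.
lemma SphericalCopositive.dist_eq_pi_of_perimeter_lt (hW : SphericalCopositive Y)
    (hd : ∀ x y : Y, dist x y ≤ Real.pi) {c : Y} {γ : ℝ → Y} {m : ℝ} (hγ : IsUnitSpeed γ m)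
    (hm : m < Real.pi) (hper : 2 * Real.pi ≤ dist (γ 0) c + m + dist (γ m) c)
    (hlt : ∀ t ∈ Ico 0 m, dist (γ 0) c + t + dist (γ t) c < 2 * Real.pi) :
    dist (γ (Real.pi - dist (γ 0) c)) c = Real.pi := by
  set A := dist (γ 0) c
  set r := Real.pi - A with hr
  have hr0 : 0 ≤ r := sub_nonneg.2 (hd _ _)
  rcases (show r ≤ m by linarith [hd (γ m) c]).eq_or_lt with hrm | hrm
  · rw [hrm]
    linarith [hd (γ m) c]
  have hcont : ContinuousOn γ (Icc r m) := hγ.continuousOn.mono (Icc_subset_Icc_left hr0)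
  have hclosure : closure (Ioo r m) = Icc r m := closure_Ioo hrm.ne
  have hmem : m ∈ closure (Ioo r m) := hclosure ▸ right_mem_Icc.2 hrm.le
  have hIco {t : ℝ} (ht : t ∈ Ioo r m) : t ∈ Ico 0 m := ⟨hr0.trans ht.1.le, ht.2⟩
  have hper' : A + m + dist (γ m) c ≤ 2 * Real.pi :=
    le_on_closure (f := fun t => A + t + dist (γ t) c) (fun t ht => (hlt t (hIco ht)).le)
      (by rw [hclosure]; fun_prop) continuousOn_const hmem
  have hlimit : Real.sin m * Real.cos (dist (γ r) c) ≤
      Real.sin (m - r) * Real.cos A + Real.sin r * Real.cos (dist (γ m) c) :=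
    le_on_closure (f := fun t => Real.sin t * Real.cos (dist (γ r) c))
      (g := fun t => Real.sin (t - r) * Real.cos A + Real.sin r * Real.cos (dist (γ t) c))
      (fun t ht => hW.sin_mul_cos_dist_le_of_isUnitSpeed hγ hr0 ht.1.le ht.2.le
        (ht.2.trans hm) (hlt t (hIco ht)))
      (by fun_prop) (by rw [hclosure]; fun_prop) hmem
  have hsin : Real.sin m = Real.sin (A + m) * Real.cos A - Real.cos (A + m) * Real.sin A := by
    rw [← Real.sin_sub, add_sub_cancel_left]
  rw [show dist (γ m) c = 2 * Real.pi - (A + m) by linarith, Real.cos_two_pi_sub,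
    show m - r = A + m - Real.pi by rw [hr]; ring, Real.sin_sub_pi, hr, Real.sin_pi_sub, ← hr]
    at hlimit
  refine dist_eq_pi_of_cos_le (hd _ _) (le_of_mul_le_mul_left ?_
    (Real.sin_pos_of_pos_of_lt_pi (hr0.trans_lt hrm) hm))
  linarith

lemma IsUnitSpeed.mono {γ : ℝ → Y} {L m : ℝ} (hγ : IsUnitSpeed γ L) (hm : m ≤ L) :
    IsUnitSpeed γ m :=
  fun s hs t ht => hγ s (Icc_subset_Icc_right hm hs) t (Icc_subset_Icc_right hm ht)

lemma IsUnitSpeed.reverse {γ : ℝ → Y} {L : ℝ} (hγ : IsUnitSpeed γ L) :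
    IsUnitSpeed (fun t => γ (L - t)) L := by
  intro s hs t ht
  rw [hγ _ ⟨sub_nonneg.2 hs.2, sub_le_self _ hs.1⟩ _ ⟨sub_nonneg.2 ht.2, sub_le_self _ ht.1⟩,
    sub_sub_sub_cancel_left, abs_sub_comm]

lemma SphericalCopositive.dist_eq_pi_of_two_pi_le (hW : SphericalCopositive Y)
    (hd : ∀ x y : Y, dist x y ≤ Real.pi) {c : Y} {γ : ℝ → Y} {L : ℝ} (hγ : IsUnitSpeed γ L)
    (hL0 : 0 ≤ L) (hL : L < Real.pi) (hper : 2 * Real.pi ≤ dist (γ 0) c + L + dist (γ L) c) :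
    dist (γ (Real.pi - dist (γ 0) c)) c = Real.pi := by
  have hcont : ContinuousOn (fun t => dist (γ 0) c + t + dist (γ t) c) (Icc 0 L) := by
    have := hγ.continuousOn
    fun_prop
  obtain ⟨m, ⟨⟨-, hmL⟩, hm⟩, hmin⟩ := (isCompact_Icc.of_isClosed_subset
    (hcont.preimage_isClosed_of_isClosed isClosed_Icc (isClosed_Ici (a := 2 * Real.pi)))
    inter_subset_left).exists_isLeast ⟨L, ⟨hL0, le_rfl⟩, hper⟩
  refine hW.dist_eq_pi_of_perimeter_lt hd (hγ.mono hmL) (hmL.trans_lt hL) hm fun t ht => ?_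
  by_contra! hle
  exact ht.2.not_ge (hmin ⟨⟨ht.1, ht.2.le.trans hmL⟩, hle⟩)

-- A point near `c` on the way from the middle antipode `z` to `c` violates the comparison.
lemma SphericalCopositive.not_three_antipodes (hW : SphericalCopositive Y)
    (hY : IsGeodesicSpace Y) {x y z c : Y} {h : ℝ} (hh : 0 < h) (hh' : 2 * h < 1)
    (hxz : dist x z = h) (hzy : dist z y = h) (hxy : dist x y = h + h) (hxc : dist x c = Real.pi)
    (hyc : dist y c = Real.pi) (hzc : dist z c = Real.pi) : False := by
  have hπ := Real.pi_gt_three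
  obtain ⟨v, hzv, hvc⟩ := hY.exists_dist_eq (x := z) (y := c) (t := Real.pi - 1) (by linarith)
    (by linarith)
  have cos_le {u : Y} (huz : dist u z = h) (huc : dist u c = Real.pi) :
      Real.cos (dist u v) ≤ -Real.cos 1 := by
    rw [← Real.cos_pi_sub]
    exact Real.cos_le_cos_of_nonneg_of_le_pi (by linarith)
      (by linarith [dist_triangle u z v]) (by linarith [dist_triangle u v c])
  have hle := hW.sin_add_mul_cos_dist_le hxz hzy hxy (by linarith) (w := v)
    (by linarith [dist_triangle x z v, dist_triangle_left y v z])
  rw [hzv, Real.cos_pi_sub, ← two_mul, Real.sin_two_mul] at hle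
  have hsin : 0 < Real.sin h := Real.sin_pos_of_pos_of_lt_pi hh (by linarith)
  have hcos : Real.cos h < 1 :=
    Real.cos_zero ▸ Real.cos_lt_cos_of_nonneg_of_le_pi le_rfl (by linarith) hh
  have hlt := mul_lt_mul_of_pos_left hcos (mul_pos hsin Real.cos_one_pos)
  linarith [mul_le_mul_of_nonneg_left (cos_le hxz hxc) hsin.le,
    mul_le_mul_of_nonneg_left (cos_le ((dist_comm y z).trans hzy) hyc) hsin.le]

lemma SphericalCopositive.dist_eq_pi_of_two_pi_add_lt (hW : SphericalCopositive Y)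
    (hd : ∀ x y : Y, dist x y ≤ Real.pi) {c : Y} {γ : ℝ → Y} {L η : ℝ} (hγ : IsUnitSpeed γ L)
    (hL0 : 0 ≤ L) (hL : L ≤ Real.pi) (hη : 0 ≤ η)
    (hper : 2 * Real.pi + η < dist (γ 0) c + L + dist (γ L) c) :
    dist (γ (Real.pi - dist (γ 0) c + η)) c = Real.pi := by
  have hcont : ContinuousOn (fun t => dist (γ 0) c + t + dist (γ t) c) (Icc 0 L) := by
    have := hγ.continuousOn
    fun_prop
  obtain ⟨m, ⟨hm0, hmL⟩, hm⟩ := intermediate_value_Icc hL0 hcont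
    ⟨show _ ≤ 2 * Real.pi + η by linarith [hd (γ 0) c], hper.le⟩
  dsimp only at hm
  have hmL' : m < L := hmL.lt_of_ne (by rintro rfl; exact hper.ne' hm)
  have hanti := hW.dist_eq_pi_of_two_pi_le hd (hγ.mono hmL).reverse (c := c) hm0
    (hmL'.trans_le hL) (by rw [sub_zero, sub_self]; linarith)
  rwa [sub_zero, show m - (Real.pi - dist (γ m) c) = Real.pi - dist (γ 0) c + η by linarith]
    at hanti

lemma SphericalCopositive.perimeter_le (hW : SphericalCopositive Y) (hY : IsGeodesicSpace Y)
    (hd : ∀ x y : Y, dist x y ≤ Real.pi) (x y c : Y) :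
    dist x c + dist x y + dist y c ≤ 2 * Real.pi := by
  by_contra! hlt
  have hxy : 0 < dist x y := by linarith [hd x c, hd y c]
  obtain ⟨γ, rfl, hγy, hγ⟩ := hY.exists_isUnitSpeed hxy
  set L := dist (γ 0) y
  set r := Real.pi - dist (γ 0) c
  obtain ⟨h, hh0, hh⟩ : ∃ h > 0,
      h < min (1 / 2) ((dist (γ 0) c + L + dist y c - 2 * Real.pi) / 2) :=
    exists_between (lt_min one_half_pos (by linarith))
  obtain ⟨hh₁, hh₂⟩ := lt_min_iff.1 hh
  have antipode {η : ℝ} (hη0 : 0 ≤ η) (hη : η ≤ 2 * h) : dist (γ (r + η)) c = Real.pi :=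
    hW.dist_eq_pi_of_two_pi_add_lt hd hγ hxy.le (hd _ _) hη0 (by rw [hγy]; linarith)
  have hr0 : 0 ≤ r := sub_nonneg.2 (hd _ _)
  have hrL : r + 2 * h ≤ L := by linarith [hd y c]
  refine hW.not_three_antipodes hY (x := γ (r + 0)) (z := γ (r + h)) (y := γ (r + 2 * h)) (c := c)
    hh0 (by linarith) ?_ ?_ ?_ (antipode le_rfl (by linarith)) (antipode (by linarith) le_rfl)
    (antipode hh0.le (by linarith))
  all_goals rw [hγ.dist_eq (by linarith) (by linarith) (by linarith)]; ring

lemma SphericalCopositive.sin_mul_gramAt_le (hW : SphericalCopositive Y) (hY : IsGeodesicSpace Y)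
    (hd : ∀ x y : Y, dist x y ≤ Real.pi) {γ : ℝ → Y} {L s : ℝ} (hγ : IsUnitSpeed γ L)
    (hL : L < Real.pi) (hs : s ∈ Icc 0 L) {p w : Y} (hp : γ 0 = p)
    (hsw : s ≤ Real.pi - dist p w) :
    Real.sin L * gramAt sphericalGram p (γ s) w ≤ Real.sin s * gramAt sphericalGram p (γ L) w := by
  have hL0 : 0 ≤ L := hs.1.trans hs.2
  rw [hγ.gramAt_eq _ hp w hs.1 hs.2, hγ.gramAt_eq _ hp w hL0 le_rfl, sphericalGram, sphericalGram]
  subst hp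
  have hdistL := hγ.dist_eq le_rfl hL0 le_rfl
  rcases (hW.perimeter_le hY hd (γ 0) (γ L) w).eq_or_lt with hper | hper
  · have hanti := hW.dist_eq_pi_of_two_pi_le hd hγ hL0 hL (c := w) (by linarith)
    have hγs : dist (γ s) w = s + dist (γ 0) w := by
      have upper := dist_triangle_left (γ s) w (γ 0)
      have lower := dist_triangle_left (γ (Real.pi - dist (γ 0) w)) w (γ s)
      rw [hγ.dist_eq le_rfl hs.1 hs.2] at upper
      rw [hγ.dist_eq hs.1 hsw (by linarith [hd (γ L) w]), hanti] at lower
      linarith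
    rw [hγs, show dist (γ L) w = 2 * Real.pi - (L + dist (γ 0) w) by linarith,
      Real.cos_two_pi_sub, Real.cos_add, Real.cos_add]
    linarith
  · have := hW.sin_mul_cos_dist_le_of_isUnitSpeed hγ hs.1 hs.2 le_rfl hL (c := w) (by linarith)
    rw [Real.sin_sub] at this
    linarith

lemma exists_le_sin_eq_sin_mul_sin {m L : ℝ} (hm : m ∈ Icc 0 1) (hL : L ∈ Icc 0 Real.pi) :
    ∃ s ∈ Icc 0 L, s ≤ m ∧ Real.sin s = Real.sin m * Real.sin L := by
  have hsm : 0 ≤ Real.sin m :=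
    Real.sin_nonneg_of_nonneg_of_le_pi hm.1 (hm.2.trans (by linarith [Real.pi_gt_three]))
  have hsL : 0 ≤ Real.sin L := Real.sin_nonneg_of_nonneg_of_le_pi hL.1 hL.2
  have mem : Real.sin m * Real.sin L ∈ Icc (Real.sin 0) (Real.sin (min L m)) := by
    rw [Real.sin_zero]
    refine ⟨mul_nonneg hsm hsL, ?_⟩
    rcases min_choice L m with h | h <;> rw [h]
    · exact mul_le_of_le_one_left hsL (Real.sin_le_one m)
    · exact mul_le_of_le_one_right hsm (Real.sin_le_one L)
  obtain ⟨s, ⟨hs0, hs⟩, hsin⟩ :=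
    intermediate_value_Icc (le_min hL.1 hm.1) Real.continuous_sin.continuousOn mem
  exact ⟨s, ⟨hs0, hs.trans (min_le_left _ _)⟩, hs.trans (min_le_right _ _), hsin⟩

lemma SphericalCopositive.exists_contracts (hW : SphericalCopositive Y) (hY : IsGeodesicSpace Y)
    (hd : ∀ x y : Y, dist x y ≤ Real.pi) {m : ℝ} (hm : m ∈ Ioc 0 1) {p x : Y}
    (hx : dist p x ≤ Real.pi - m) :
    ∃ x', dist p x' ≤ m ∧ Contracts (gramAt sphericalGram p)
      (fun x w => dist p x ≤ Real.pi - m ∧ dist p w ≤ Real.pi - m) (Real.sin m) x x' := by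
  have hπ := Real.pi_gt_three
  rcases (dist_nonneg (x := p) (y := x)).eq_or_lt with hpx | hpx
  · refine ⟨x, hpx ▸ hm.1.le, fun w hw => ⟨?_, hw⟩⟩
    rw [gramAt_eq_zero_of_dist_eq_zero (fun b => by simp [sphericalGram]) hpx.symm, mul_zero]
  · have hxπ : dist p x < Real.pi := by linarith [hm.1]
    obtain ⟨γ, hγ0, hγL, hγ⟩ := hY.exists_isUnitSpeed hpx
    obtain ⟨s, hs, hsm, hsin⟩ := exists_le_sin_eq_sin_mul_sin (Ioc_subset_Icc_self hm)
      ⟨hpx.le, hxπ.le⟩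
    have hps : dist p (γ s) = s := by rw [← hγ0, hγ.dist_eq le_rfl hs.1 hs.2, sub_zero]
    refine ⟨γ s, hps.trans_le hsm, fun w hw => ⟨?_, by linarith [hm.2], hw.2⟩⟩
    have := hW.sin_mul_gramAt_le hY hd hγ hxπ hs hγ0 (w := w) (by linarith [hw.2])
    rw [hγL, hsin, mul_right_comm, mul_comm] at this
    exact le_of_mul_le_mul_right this (Real.sin_pos_of_pos_of_lt_pi hpx hxπ)

lemma exists_forall_le_sub {ι : Type*} [Finite ι] {f : ι → ℝ} {M : ℝ} (hf : ∀ i, f i < M) :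
    ∃ m ∈ Ioc (0 : ℝ) 1, ∀ i, f i ≤ M - m := by
  have hle : ∀ᶠ m in 𝓝[>] (0 : ℝ), ∀ i, f i ≤ M - m := eventually_all.2 fun i =>
    mem_of_superset (Ioc_mem_nhdsGT (sub_pos.2 (hf i))) fun _ hm => le_sub_comm.1 hm.2
  have hIoc : ∀ᶠ m in 𝓝[>] (0 : ℝ), m ∈ Ioc (0 : ℝ) 1 := Ioc_mem_nhdsGT one_pos
  exact (hIoc.and hle).exists

lemma SphericalCopositive.gramSumNonneg (hW : SphericalCopositive Y) (hY : IsGeodesicSpace Y)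
    (hd : ∀ x y : Y, dist x y ≤ Real.pi) : GramSumNonneg sphericalGram Y := by
  intro p x
  by_cases hlt : ∀ i, dist p (x i) < Real.pi
  · obtain ⟨m, hm, hmx⟩ := exists_forall_le_sub hlt
    have hρ : 0 < Real.sin m :=
      Real.sin_pos_of_pos_of_lt_pi hm.1 (by linarith [hm.2, Real.pi_gt_three])
    choose x' hx'm hx' using fun i => hW.exists_contracts hY hd hm (hmx i)
    have hper (i j : Fin 3) : dist p (x' i) + dist p (x' j) + dist (x' i) (x' j) < 2 * Real.pi := by
      linarith [hx'm i, hx'm j, hm.2, dist_triangle_left (x' i) (x' j) p, Real.pi_gt_three]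
    have hsum := (hW p x' hper).sum_nonneg.trans
      (sum_sum_le_of_contracts (gramAt_comm sphericalGram_comm p) (fun _ _ => And.symm)
        (fun _ => hρ.le) (fun i j => ⟨hmx i, hmx j⟩) hx')
    simp only [← Finset.mul_sum] at hsum
    exact nonneg_of_mul_nonneg_right hsum (mul_pos hρ hρ)
  · push Not at hlt
    obtain ⟨k, hk⟩ := hlt
    refine (copositive_of_eq_zero (s := fun i => Real.sin (dist p (x i))) (k := k)
      (fun i j => gramAt_comm sphericalGram_comm p _ _) (fun i => gramAt_sphericalGram_self p (x i))
      (fun i j => abs_sphericalGram_le ?_ (dist_triangle_left _ _ _) ?_) ?_).sum_nonneg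
    · simpa [dist_comm] using abs_dist_sub_le (x i) (x j) p
    · linarith [hW.perimeter_le hY hd p (x i) (x j)]
    · rw [(hd p (x k)).antisymm hk, Real.sin_pi]

end DiameterPi

section QuadrupleInequalities

variable {X : Type*} [MetricSpace X] {κ : ℝ}

lemma gramSumNonneg_iff_sphericalInequality (hκ : 0 < κ) :
    GramSumNonneg (modelGram κ) X ↔ SphericalInequality κ X := by
  simp only [GramSumNonneg, SphericalInequality, gramAt, modelGram_of_pos hκ, sphericalGram,
    Finset.sum_sub_distrib, ← Finset.sum_mul_sum, ← sq, sub_nonneg]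

lemma gramSumNonneg_iff_hyperbolicInequality (hκ : κ < 0) :
    GramSumNonneg (modelGram κ) X ↔ HyperbolicInequality κ X := by
  simp only [GramSumNonneg, HyperbolicInequality, gramAt, modelGram_of_neg hκ, hyperbolicGram,
    Finset.sum_sub_distrib, ← Finset.sum_mul_sum, ← sq, sub_nonneg]

lemma gramSumNonneg_iff_euclideanInequality :
    GramSumNonneg (modelGram 0) X ↔ EuclideanInequality X := by
  rw [modelGram_zero]
  refine ⟨fun h p x y z => ?_, fun h p x => ?_⟩
  · rw [dist_comm z x]
    linarith [h.euclidean p x y z]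
  · have := h p (x 0) (x 1) (x 2)
    simp only [Fin.sum_univ_three, gramAt, euclideanGram, dist_self, dist_comm (x 1) (x 0),
      dist_comm (x 2) (x 1), dist_comm (x 0) (x 2)]
    linarith

lemma gramSumNonneg_ultralimit_iff {G : ℝ → ℝ → ℝ → ℝ}
    (hG : Continuous fun v : ℝ × ℝ × ℝ => G v.1 v.2.1 v.2.2) (k : ℝ≥0) :
    GramSumNonneg G (Ultralimit k X) ↔
      GramSumNonneg (fun a b c => G (k * a) (k * b) (k * c)) X := by
  refine ⟨fun h p x => ?_, fun h p x => ?_⟩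
  · simpa only [Ultralimit.gramAt_const] using h (.const k p) fun i => .const k (x i)
  · exact ge_of_tendsto' (tendsto_finsetSum _ fun i _ => tendsto_finsetSum _ fun j _ =>
      Ultralimit.tendsto_gramAt hG p (x i) (x j)) fun n => h (p.1 n) fun i => (x i).1 n

lemma gramSumNonneg_ultralimit_iff_sphericalInequality (hκ : 0 < κ) :
    GramSumNonneg sphericalGram (Ultralimit (√κ).toNNReal X) ↔ SphericalInequality κ X := by
  rw [gramSumNonneg_ultralimit_iff continuous_sphericalGram,
    Real.coe_toNNReal _ (Real.sqrt_nonneg κ), ← modelGram_of_pos hκ,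
    gramSumNonneg_iff_sphericalInequality hκ]

lemma gramSumNonneg_ultralimit_iff_hyperbolicInequality (hκ : κ < 0) :
    GramSumNonneg hyperbolicGram (Ultralimit (√(-κ)).toNNReal X) ↔ HyperbolicInequality κ X := by
  rw [gramSumNonneg_ultralimit_iff continuous_hyperbolicGram,
    Real.coe_toNNReal _ (Real.sqrt_nonneg (-κ)), ← modelGram_of_neg hκ,
    gramSumNonneg_iff_hyperbolicInequality hκ]

lemma gramSumNonneg_ultralimit_iff_euclideanInequality :
    GramSumNonneg euclideanGram (Ultralimit 1 X) ↔ EuclideanInequality X := by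
  rw [gramSumNonneg_ultralimit_iff continuous_euclideanGram,
    ← gramSumNonneg_iff_euclideanInequality, modelGram_zero]
  simp only [NNReal.coe_one, one_mul]

lemma sphericalCopositive_ultralimit_iff_gramCopositive (hκ : 0 < κ) :
    SphericalCopositive (Ultralimit (√κ).toNNReal X) ↔ GramCopositive κ X := by
  have hk : √κ = (√κ).toNNReal := (Real.coe_toNNReal _ (Real.sqrt_nonneg κ)).symm
  generalize (√κ).toNNReal = k at hk ⊢
  simp only [GramCopositive, modelGram_of_pos hκ, SmallPerimeter, hκ, forall_const,
    add_add_lt_two_pi_iff_of_pos hκ]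
  simp only [hk]
  refine ⟨fun h p x hper => ?_, fun h p x hper a ha => ?_⟩
  · simp only [← Ultralimit.dist_const, ← Ultralimit.gramAt_const] at hper ⊢
    exact h _ _ hper
  · have hper_n : ∀ᶠ n in hyperfilter ℕ, ∀ i j, k * dist (p.1 n) ((x i).1 n) +
        k * dist (p.1 n) ((x j).1 n) + k * dist ((x i).1 n) ((x j).1 n) < 2 * Real.pi :=
      eventually_all.2 fun i => eventually_all.2 fun j =>
        (((p.tendsto_dist (x i)).add (p.tendsto_dist (x j))).add
          ((x i).tendsto_dist (x j))).eventually_lt_const (hper i j)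
    refine ge_of_tendsto (tendsto_finsetSum _ fun i _ => tendsto_finsetSum _ fun j _ =>
      (Ultralimit.tendsto_gramAt continuous_sphericalGram p (x i) (x j)).const_mul (a i * a j)) ?_
    filter_upwards [hper_n] with n hn
    exact h (p.1 n) (fun i => (x i).1 n) hn a ha

lemma Ultralimit.dist_le {k : ℝ≥0} {M : ℝ} (h : ∀ x y : X, k * dist x y ≤ M)
    (u v : Ultralimit k X) : dist u v ≤ M :=
  le_of_tendsto' (tendsto_dist u v) fun n => h (u.1 n) (v.1 n)

lemma IsAlexandrovSpace.sphericalInequality (h : IsAlexandrovSpace κ X) (hκ : 0 < κ)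
    (hd : ∀ x y : X, dist x y ≤ Real.pi / √κ) : SphericalInequality κ X := by
  rw [← gramSumNonneg_ultralimit_iff_sphericalInequality hκ]
  refine ((sphericalCopositive_ultralimit_iff_gramCopositive hκ).2 h.gramCopositive).gramSumNonneg
    (Ultralimit.isGeodesicSpace h.intrinsic _) (Ultralimit.dist_le fun x y => ?_)
  rw [Real.coe_toNNReal _ (Real.sqrt_nonneg κ)]
  exact (le_div_iff₀' (Real.sqrt_pos.2 hκ)).1 (hd x y)

lemma IsAlexandrovSpace.gramSumNonneg (h : IsAlexandrovSpace κ X) (hκ : κ ≤ 0) :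
    GramSumNonneg (modelGram κ) X :=
  fun p x => (h.gramCopositive p x fun _ _ hpos => absurd hpos hκ.not_gt).sum_nonneg

variable [CompleteSpace X]

lemma SphericalInequality.isAlexandrovSpace (h : SphericalInequality κ X) (hκ : 0 < κ)
    (hX : IsIntrinsic X) : IsAlexandrovSpace κ X := by
  rw [← gramSumNonneg_ultralimit_iff_sphericalInequality hκ] at h
  refine GramCopositive.isAlexandrovSpace hX ?_
  rw [← sphericalCopositive_ultralimit_iff_gramCopositive hκ]
  exact (Ultralimit.isGeodesicSpace hX _).sphericalCopositive h

lemma HyperbolicInequality.isAlexandrovSpace (h : HyperbolicInequality κ X) (hκ : κ < 0)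
    (hX : IsIntrinsic X) : IsAlexandrovSpace κ X := by
  rw [← gramSumNonneg_ultralimit_iff_hyperbolicInequality hκ] at h
  refine GramCopositive.isAlexandrovSpace hX fun p x _ => ?_
  simpa only [Ultralimit.gramAt_const, Real.coe_toNNReal _ (Real.sqrt_nonneg (-κ)),
    modelGram_of_neg hκ] using (Ultralimit.isGeodesicSpace hX _).copositive_hyperbolicGram h
      (.const _ p) fun i => .const _ (x i)

lemma EuclideanInequality.isAlexandrovSpace (h : EuclideanInequality X) (hX : IsIntrinsic X) :
    IsAlexandrovSpace 0 X := by
  rw [← gramSumNonneg_ultralimit_iff_euclideanInequality] at h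
  refine GramCopositive.isAlexandrovSpace hX fun p x _ => ?_
  simpa only [Ultralimit.gramAt_const, NNReal.coe_one, one_mul, modelGram_zero] using
    (Ultralimit.isGeodesicSpace hX 1).copositive_euclideanGram h (.const 1 p)
      fun i => .const 1 (x i)

end QuadrupleInequalities

end AlexandrovCBB

theorem mainTheorem2 {X : Type*} [MetricSpace X] [CompleteSpace X]
    (hX : AlexandrovCBB.IsIntrinsic X) :
    -- `κ = 1`; the diameter bound is needed in one direction only
    ((∀ (p : X) (x : Fin 3 → X),
        (∑ i, Real.cos (dist p (x i))) ^ 2 ≤ ∑ i, ∑ j, Real.cos (dist (x i) (x j))) →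
      AlexandrovCBB.IsAlexandrovSpace 1 X) ∧
    ((∀ x y : X, dist x y ≤ Real.pi) →
      (AlexandrovCBB.IsAlexandrovSpace 1 X ↔
        ∀ (p : X) (x : Fin 3 → X),
          (∑ i, Real.cos (dist p (x i))) ^ 2 ≤ ∑ i, ∑ j, Real.cos (dist (x i) (x j)))) ∧
    -- `κ = -1`
    (AlexandrovCBB.IsAlexandrovSpace (-1) X ↔
      ∀ (p : X) (x : Fin 3 → X),
        (∑ i, Real.cosh (dist p (x i))) ^ 2 ≥ ∑ i, ∑ j, Real.cosh (dist (x i) (x j))) ∧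
    -- arbitrary `κ`
    (∀ κ : ℝ, 0 < κ →
      (AlexandrovCBB.SphericalInequality κ X → AlexandrovCBB.IsAlexandrovSpace κ X) ∧
      ((∀ x y : X, dist x y ≤ Real.pi / √κ) →
        (AlexandrovCBB.IsAlexandrovSpace κ X ↔ AlexandrovCBB.SphericalInequality κ X))) ∧
    (AlexandrovCBB.IsAlexandrovSpace 0 X ↔ AlexandrovCBB.EuclideanInequality X) ∧
    (∀ κ : ℝ, κ < 0 →
      (AlexandrovCBB.IsAlexandrovSpace κ X ↔ AlexandrovCBB.HyperbolicInequality κ X)) := by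
  have pos (κ : ℝ) (hκ : 0 < κ) :
      (AlexandrovCBB.SphericalInequality κ X → AlexandrovCBB.IsAlexandrovSpace κ X) ∧
      ((∀ x y : X, dist x y ≤ Real.pi / √κ) →
        (AlexandrovCBB.IsAlexandrovSpace κ X ↔ AlexandrovCBB.SphericalInequality κ X)) :=
    ⟨fun h => h.isAlexandrovSpace hκ hX, fun hd =>
      ⟨fun h => h.sphericalInequality hκ hd, fun h => h.isAlexandrovSpace hκ hX⟩⟩
  have zero : AlexandrovCBB.IsAlexandrovSpace 0 X ↔ AlexandrovCBB.EuclideanInequality X :=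
    ⟨fun h => AlexandrovCBB.gramSumNonneg_iff_euclideanInequality.1 (h.gramSumNonneg le_rfl),
      fun h => h.isAlexandrovSpace hX⟩
  have neg (κ : ℝ) (hκ : κ < 0) :
      AlexandrovCBB.IsAlexandrovSpace κ X ↔ AlexandrovCBB.HyperbolicInequality κ X :=
    ⟨fun h => (AlexandrovCBB.gramSumNonneg_iff_hyperbolicInequality hκ).1 (h.gramSumNonneg hκ.le),
      fun h => h.isAlexandrovSpace hκ hX⟩
  have pos_one := pos 1 one_pos
  have neg_one := neg (-1) (neg_neg_of_pos one_pos)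
  simp only [AlexandrovCBB.SphericalInequality, Real.sqrt_one, one_mul, div_one] at pos_one
  simp only [AlexandrovCBB.HyperbolicInequality, neg_neg, Real.sqrt_one, one_mul] at neg_one
  exact ⟨pos_one.1, pos_one.2, neg_one, pos, zero, neg⟩
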